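/- **Setting.** Let $G$ be a simple undirected graph with $n$ vertices and $m$ edges. Let $m$ arbitrary distinct real weights be assigned to the edges by a uniformly random permutation (any exchangeable, almost surely distinct weights, e.g. i.i.d. weights with a continuous distribution, are of this form conditionally on the set of weight values). Fix a constant $c>3$. *Filter-Borůvka* maintains an array $P$ that stores for each of the $n$ vertices a representative of its component in the forest found so far (initially the identity). On an edge sequence $E$ (parallel edges allowed, self-loops not) it proceeds as follows. If $|E|\le cn$, it calls a base case minimum spanning forest (MSF) algorithm on $E$, which outputs the MSF edges and a component representative for each vertex, with which $P$ is updated. Otherwise it draws a uniformly random pivot edge from $E$ and partitions $E$ into the light edges $E_{\le}$ (weight at most that of the pivot) and the heavy edges $E_{>}$; this is repeated with a fresh pivot until $|E_{\le}|,|E_{>}|\ge |E|/3$. It recurses on $E_{\le}$; then it filters $E_{>}$, replacing each end vertex by its representative in $P$ and discarding the edges that become self-loops, i.e. those inside a component of the MSF of $E_{\le}$; then it recurses on the remaining heavy edges. **Theorem.** 1. (Sequential running time.) Let the base case be sequential Borůvka's algorithm, in which each round determines the lightest incident edge of each vertex, contracts the components formed by these edges, using pointer doubling, and deletes self-loops.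 Count elementary operations (reading or writing an array cell, comparison, drawing a random array position, etc.) as steps. There is a constant $C$ depending only on $c$ such that for all $n\ge 2$, all $m$ and all $G$ as above, the expected number of steps is at most $$C\Bigl(m+n\log n\,\log\bigl(2+\tfrac mn\bigr)\Bigr).$$ 2. (Parallel span.) Let partitioning, filtering and the initialization of $P$ be done by parallel loops, prefix sums and compactions in the binary fork-join model, where such an operation with constant work per element on $k$ elements has span $O(1+\log k)$. Let the base case run an arbitrary, possibly randomized, parallel MSF implementation $B$ (for example parallel Borůvka) that outputs the MSF and component representatives, followed by parallel loops that store the representatives of all $n$ vertices in $P$ and append the new forest edges to the output. Let $S_B(n)$ be the worst-case expected span of this base case procedure (including these loops) over inputs with $n$ vertices and at most $cn$ edges. There is a constant $C$ depending only on $c$ such that for all $n$, $m$, $G$ and $B$, the expected span of Filter-Borůvka is at most $$C\,\log\bigl(2+\tfrac mn\bigr)\,S_B(n)$$ (with $m/n:=0$ for $n=0$). All expectations are over the random weight assignment and the random choices of the algorithm (and of $B$). For $m\ge 2n$ the factor $\log(2+m/n)$ is at most $2\log(m/n)$, so that the bounds are $O(m+n\log n\log(m/n))$ and $O(\log(m/n))\cdot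 S_B(n)$. -/

import Mathlib

open scoped ENNReal

noncomputable section

namespace FilterBoruvka

/-! ## Cost models

`Timed α` is a value together with the number of steps used to compute it.  A step is an elementary
operation (array read, array write, comparison, arithmetic, list push).  Sequential composition adds
the costs.  Sequential code uses `seqLoop`, and its cost is its running time.  Parallel code also
uses the binary fork-join bulk operations below, and its cost is its span (the length of the critical
path, with no bound on the number of processors). -/

structure Timed (α : Type) where
  val : α
  cost : ℕ

instance : Monad Timed where
  pure a := ⟨a, 0⟩
  bind x f := ⟨(f x.val).val, x.cost + (f x.val).cost⟩

/-- Spend `k` steps. -/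
def tick (k : ℕ) : Timed Unit := ⟨(), k⟩

/-- Read one cell of an array. -/
def rd {ι α : Type} (A : ι → α) (i : ι) : Timed α := ⟨A i, 1⟩

/-- Write one cell of an array. -/
def wr {ι α : Type} [DecidableEq ι] (A : ι → α) (i : ι) (x : α) : Timed (ι → α) :=
  ⟨Function.update A i x, 1⟩

/-- Sequential loop over a sequence with loop state `σ`: one step of overhead per iteration. -/
def seqLoop {α σ : Type} (f : σ → α → Timed σ) : List α → σ → Timed σ
  | [], s => do
      tick 1
      pure s
  | a :: l, s => do
      tick 1
      let s' ← f s a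
      seqLoop f l s'

/-- Parallel loop over a sequence of length `k`: a binary fork tree of depth `⌈log₂ k⌉`, whose leaves
execute the loop body. -/
def parMap {α β : Type} (f : α → Timed β) (l : List α) : Timed (List β) :=
  ⟨l.map fun a => (f a).val, Nat.clog 2 l.length + (l.map fun a => (f a).cost).foldr max 0 + 1⟩

/-- Parallel loop that fills an array indexed by the vertices. -/
def parTabulate {n : ℕ} {β : Type} (f : Fin n → Timed β) : Timed (Fin n → β) :=
  ⟨fun v => (f v).val, Nat.clog 2 n + (Finset.univ.sup fun v => (f v).cost) + 1⟩

/-- Parallel compaction: a parallel loop evaluates the predicate, a prefix sum (an upward and a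
downward sweep over the fork tree) computes the target positions, and a parallel loop moves the
selected elements. -/
def parPack {α : Type} (p : α → Timed Bool) (l : List α) : Timed (List α) :=
  ⟨l.filter fun a => (p a).val,
    (parMap p l).cost + 2 * (Nat.clog 2 l.length + 1) + (Nat.clog 2 l.length + 1)⟩

/-- Append the first sequence to the second one by a parallel loop over the first one. -/
def parAppend {α : Type} (l l' : List α) : Timed (List α) :=
  ⟨l ++ l', Nat.clog 2 l.length + 1⟩

/-! ## Randomized programs -/

/-- A randomized program: the joint law of its result and its cost.  The result `none` means that
the program was interrupted; the cost is then the cost up to the interruption. -/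
def Rand (α : Type) : Type := PMF (Option α × ℕ)

namespace Rand

/-- Sequential composition: costs add up, and an interruption interrupts the whole program. -/
def andThen {α β : Type} (x : Rand α) (f : α → Rand β) : Rand β :=
  PMF.bind x fun r =>
    match r with
    | (none, t) => PMF.pure (none, t)
    | (some a, t) => PMF.map (fun s : Option β × ℕ => (s.1, t + s.2)) (f a)

instance : Monad Rand where
  pure a := PMF.pure (some a, 0)
  bind := andThen

/-- A deterministic program. -/
def lift {α : Type} (x : Timed α) : Rand α := PMF.pure (some x.val, x.cost)

/-- A randomized program that is never interrupted. -/
def ofPMF {α : Type} (p : PMF (α × ℕ)) : Rand α := PMF.map (fun r => (some r.1, r.2)) p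

/-- Interrupt the program. -/
def interrupt {α : Type} : Rand α := PMF.pure (none, 0)

/-- Draw a uniformly random position of a nonempty sequence and read the element there. -/
def pick {α : Type} (l : List α) : Rand α :=
  if h : 0 < l.length then
    haveI : Nonempty (Fin l.length) := ⟨⟨0, h⟩⟩
    PMF.map (fun i : Fin l.length => (some (l.get i), 1)) (PMF.uniformOfFintype (Fin l.length))
  else interrupt

/-- The expected cost. -/
def expCost {α : Type} (x : Rand α) : ℝ≥0∞ :=
  ∑' r : Option α × ℕ, (show PMF (Option α × ℕ) from x) r * (r.2 : ℝ≥0∞)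

end Rand

/-! ## Graphs -/

/-- A simple undirected graph with `n` vertices and `m` edges, as a sequence of edges. -/
structure InputGraph (n m : ℕ) where
  ends : Fin m → Fin n × Fin n
  loopless : ∀ i, (ends i).1 ≠ (ends i).2
  simple : Function.Injective fun i => s((ends i).1, (ends i).2)

/-- An undirected weighted edge.  Its end vertices change when edges are contracted; its `tag`
identifies the original edge. -/
structure Edge (n : ℕ) where
  src : Fin n
  dst : Fin n
  wt : ℝ
  tag : ℕ

/-- The edge sequence of a graph with edge weights `w`. -/
def InputGraph.edges {n m : ℕ} (G : InputGraph n m) (w : Fin m → ℝ) : List (Edge n) :=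
  List.ofFn fun i => ⟨(G.ends i).1, (G.ends i).2, w i, i⟩

/-- The inputs of an MSF algorithm: no self-loops, distinct weights, distinct tags.  Parallel edges,
which appear when edges are contracted, are allowed. -/
def ValidInput {n : ℕ} (es : List (Edge n)) : Prop :=
  (∀ e ∈ es, e.src ≠ e.dst) ∧ (es.map Edge.wt).Nodup ∧ (es.map Edge.tag).Nodup

/-- `u` and `v` are in the same connected component. -/
def Connected {n : ℕ} (es : List (Edge n)) (u v : Fin n) : Prop :=
  Relation.ReflTransGen
    (fun a b => ∃ e ∈ es, (e.src = a ∧ e.dst = b) ∨ (e.src = b ∧ e.dst = a)) u v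

/-- `F` is a subset of the edges with the same connected components and without cycles. -/
def IsSpanningForest {n : ℕ} (es F : List (Edge n)) : Prop :=
  F.Sublist es ∧ (∀ u v, Connected F u v ↔ Connected es u v) ∧
    ∀ e ∈ F, ¬ Connected (F.filter fun f => f.tag ≠ e.tag) e.src e.dst

/-- `F` is a minimum spanning forest. -/
def IsMSF {n : ℕ} (es F : List (Edge n)) : Prop :=
  IsSpanningForest es F ∧
    ∀ F', IsSpanningForest es F' → (F.map Edge.wt).sum ≤ (F'.map Edge.wt).sum

/-- `L` maps every vertex to a representative of its connected component. -/
def IsComponentMap {n : ℕ} (es : List (Edge n)) (L : Fin n → Fin n) : Prop :=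
  (∀ v, Connected es v (L v)) ∧ ∀ u v, L u = L v ↔ Connected es u v

/-- The state kept by Filter-Borůvka: the array `P` of component representatives with respect to the
forest found so far, and the sequence `T` of the tags of the forest edges found so far. -/
structure Forest (n : ℕ) where
  P : Fin n → Fin n
  T : List ℕ

/-! ## The Filter-Borůvka recursion -/

/-- The subroutines of Filter-Borůvka: partitioning an edge sequence at a pivot weight into light and
heavy edges, filtering, and the base case algorithm. -/
structure Subroutines (n : ℕ) where
  partition : ℝ → List (Edge n) → Timed (List (Edge n) × List (Edge n))
  filter : (Fin n → Fin n) → List (Edge n) → Timed (List (Edge n))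
  base : List (Edge n) → Forest n → Rand (Forest n)

/-- Pivot selection and partitioning: draw a uniformly random edge, partition at its weight, and
repeat until both parts have at least one third of the edges.  The argument of type `ℕ` bounds the
number of repetitions, after which the program is interrupted. -/
def splitBalanced {n : ℕ} (S : Subroutines n) (es : List (Edge n)) :
    ℕ → Rand (List (Edge n) × List (Edge n))
  | 0 => Rand.interrupt
  | k + 1 => do
      let e ← Rand.pick es
      let q ← Rand.lift (S.partition e.wt es)
      Rand.lift (tick 1)
      if es.length ≤ 3 * q.1.length ∧ es.length ≤ 3 * q.2.length then
        pure q
      else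
        splitBalanced S es k

/-- The recursive procedure.  It switches to the base case when at most `c * n` edges are left.  The
argument of type `ℕ` bounds the recursion depth, after which the program is interrupted. -/
def filterRec {n : ℕ} (S : Subroutines n) (c : ℝ) :
    ℕ → List (Edge n) → Forest n → Rand (Forest n)
  | 0, _, _ => Rand.interrupt
  | k + 1, es, F => do
      Rand.lift (tick 1)
      if (es.length : ℝ) ≤ c * n then
        S.base es F
      else do
        let q ← splitBalanced S es k
        let F₁ ← filterRec S c k q.1 F
        let heavy ← Rand.lift (S.filter F₁.P q.2)
        filterRec S c k heavy F₁

/-- The expected cost of Filter-Borůvka on the edge sequence `es`, with `init` steps to initialize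
the array of component representatives to the identity.  The bound `k` on the recursion depth and on
the repetitions is removed by the supremum: the cost up to the interruption increases with `k` to the
total cost (and every level and repetition costs at least one step). -/
def expectedCost {n : ℕ} (S : Subroutines n) (c : ℝ) (init : ℕ) (es : List (Edge n)) : ℝ≥0∞ :=
  ⨆ k : ℕ, Rand.expCost (do
    Rand.lift (tick init)
    filterRec S c k es ⟨fun v => v, []⟩)

/-! ## The sequential algorithm -/

/-- Sequential partitioning at the weight `w`. -/
def seqPartition {n : ℕ} (w : ℝ) (es : List (Edge n)) :
    Timed (List (Edge n) × List (Edge n)) :=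
  seqLoop (fun q e => do
    tick 2
    if e.wt ≤ w then pure (e :: q.1, q.2) else pure (q.1, e :: q.2)) es ([], [])

/-- Sequential filtering: replace the end vertices of each edge by their representatives and discard
the edges that became self-loops. -/
def seqFilter {n : ℕ} (P : Fin n → Fin n) (es : List (Edge n)) : Timed (List (Edge n)) :=
  seqLoop (fun acc e => do
    let u ← rd P e.src
    let v ← rd P e.dst
    tick 2
    if u = v then pure acc else pure (⟨u, v, e.wt, e.tag⟩ :: acc)) es []

/-- Record `e` as the lightest edge at `v` if it is lighter than the recorded one. -/
def improve {n : ℕ} (best : Fin n → Option (Edge n)) (v : Fin n) (e : Edge n) :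
    Timed (Fin n → Option (Edge n)) := do
  match ← rd best v with
  | none => wr best v (some e)
  | some f => do
      tick 1
      if e.wt < f.wt then wr best v (some e) else pure best

/-- The lightest incident edge of every vertex. -/
def lightest {n : ℕ} (es : List (Edge n)) : Timed (Fin n → Option (Edge n)) := do
  tick n
  seqLoop (fun best e => do
    let best' ← improve best e.src e
    improve best' e.dst e) es (fun _ => none)

/-- The pseudo-forest in which each vertex of `vs` points along its lightest incident edge. -/
def hook {n : ℕ} (vs : List (Fin n)) (best : Fin n → Option (Edge n)) :
    Timed (Fin n → Fin n) := do
  tick n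
  seqLoop (fun par v => do
    match ← rd best v with
    | none => pure par
    | some e => do
        tick 1
        wr par v (if e.src = v then e.dst else e.src)) vs (fun v => v)

/-- Turn the pseudo-trees into rooted trees: the smaller vertex of each 2-cycle becomes a root. -/
def breakCycles {n : ℕ} (vs : List (Fin n)) (par : Fin n → Fin n) : Timed (Fin n → Fin n) :=
  seqLoop (fun par v => do
    let p ← rd par v
    let g ← rd par p
    tick 2
    if g = v ∧ v < p then wr par v v else pure par) vs par

/-- Output the lightest incident edge of each vertex that is not a root. -/
def collect {n : ℕ} (vs : List (Fin n)) (best : Fin n → Option (Edge n)) (par : Fin n → Fin n)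
    (T : List ℕ) : Timed (List ℕ) :=
  seqLoop (fun T v => do
    let p ← rd par v
    tick 1
    if p = v then pure T
    else
      match ← rd best v with
      | none => pure T
      | some e => do
          tick 1
          pure (e.tag :: T)) vs T

/-- `k` passes of pointer doubling. -/
def pointerDoubling {n : ℕ} (vs : List (Fin n)) : ℕ → (Fin n → Fin n) → Timed (Fin n → Fin n)
  | 0, par => pure par
  | k + 1, par => do
      let par' ← seqLoop (fun par v => do
        let p ← rd par v
        let g ← rd par p
        wr par v g) vs par
      pointerDoubling vs k par'

/-- The roots of the trees with at least one edge. -/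
def activeRoots {n : ℕ} (vs : List (Fin n)) (best : Fin n → Option (Edge n))
    (root : Fin n → Fin n) : Timed (List (Fin n)) :=
  seqLoop (fun acc v => do
    let r ← rd root v
    let b ← rd best v
    tick 2
    if r = v ∧ b.isSome then pure (v :: acc) else pure acc) vs []

/-- Store the component roots in the array of representatives. -/
def updateReps {n : ℕ} (root P : Fin n → Fin n) : Timed (Fin n → Fin n) :=
  seqLoop (fun P v => do
    let p ← rd P v
    let r ← rd root p
    wr P v r) (List.finRange n) P

/-- The state of Borůvka's algorithm: vertices that may have incident edges, edges of the contracted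
graph, and the forest found so far. -/
structure BoruvkaState (n : ℕ) where
  vs : List (Fin n)
  es : List (Edge n)
  forest : Forest n

/-- One Borůvka round. -/
def boruvkaRound {n : ℕ} (s : BoruvkaState n) : Timed (BoruvkaState n) := do
  let best ← lightest s.es
  let pseudo ← hook s.vs best
  let par ← breakCycles s.vs pseudo
  let T ← collect s.vs best par s.forest.T
  let root ← pointerDoubling s.vs (Nat.clog 2 s.vs.length) par
  let vs ← activeRoots s.vs best root
  let P ← updateReps root s.forest.P
  let es ← seqFilter root s.es
  pure ⟨vs, es, ⟨P, T⟩⟩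

/-- At most `k` Borůvka rounds, ending as soon as no edges are left. -/
def boruvkaRounds {n : ℕ} : ℕ → BoruvkaState n → Timed (BoruvkaState n)
  | 0, s => pure s
  | k + 1, s => do
      tick 1
      if s.es.isEmpty then pure s
      else do
        let s' ← boruvkaRound s
        boruvkaRounds k s'

/-- Borůvka's algorithm.  Each round removes a vertex, so that `n` rounds always suffice. -/
def seqBoruvka {n : ℕ} (es : List (Edge n)) (F : Forest n) : Timed (Forest n) := do
  tick n
  let s ← boruvkaRounds n ⟨List.finRange n, es, F⟩
  pure s.forest

/-- The subroutines of sequential Filter-Borůvka. -/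
def seqSubroutines (n : ℕ) : Subroutines n where
  partition := seqPartition
  filter := seqFilter
  base es F := Rand.lift (seqBoruvka es F)

/-- The expected running time of sequential Filter-Borůvka on a graph with weights `w`, over the
random choices of the algorithm. -/
def seqExpectedTime {n m : ℕ} (c : ℝ) (G : InputGraph n m) (w : Fin m → ℝ) : ℝ≥0∞ :=
  expectedCost (seqSubroutines n) c n (G.edges w)

/-! ## The parallel algorithm -/

/-- Parallel partitioning at the weight `w`. -/
def parPartition {n : ℕ} (w : ℝ) (es : List (Edge n)) :
    Timed (List (Edge n) × List (Edge n)) := do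
  let lo ← parPack (fun e => ⟨decide (e.wt ≤ w), 1⟩) es
  let hi ← parPack (fun e => ⟨decide (w < e.wt), 1⟩) es
  pure (lo, hi)

/-- Parallel filtering. -/
def parFilter {n : ℕ} (P : Fin n → Fin n) (es : List (Edge n)) : Timed (List (Edge n)) := do
  let es' ← parMap (fun e => do
    let u ← rd P e.src
    let v ← rd P e.dst
    pure (⟨u, v, e.wt, e.tag⟩ : Edge n)) es
  parPack (fun e => ⟨decide (e.src ≠ e.dst), 1⟩) es'

/-- An arbitrary, possibly randomized, parallel implementation of an MSF algorithm for `n` vertices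
(for instance of Borůvka's algorithm) that also provides component representatives.  `run es` is the
joint law of its output (representatives and tags of the forest edges) and its span. -/
structure ParallelMSF (n : ℕ) where
  run : List (Edge n) → PMF (Forest n × ℕ)
  correct : ∀ es, ValidInput es → ∀ r ∈ (run es).support,
    IsComponentMap es r.1.P ∧ ∃ F, IsMSF es F ∧ (F.map Edge.tag).Perm r.1.T

/-- The parallel base case: run `B`, then store the component representatives of all `n` vertices in
the array `P` and append the new forest edges, both by parallel loops. -/
def ParallelMSF.base {n : ℕ} (B : ParallelMSF n) (es : List (Edge n)) (F : Forest n) :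
    Rand (Forest n) := do
  let out ← Rand.ofPMF (B.run es)
  let P ← Rand.lift (parTabulate fun v => do
    let p ← rd F.P v
    rd out.P p)
  let T ← Rand.lift (parAppend out.T F.T)
  pure ⟨P, T⟩

/-- The worst-case expected span of the parallel base case on inputs with `n` vertices and at most
`c * n` edges. -/
def ParallelMSF.worstSpan {n : ℕ} (B : ParallelMSF n) (c : ℝ) : ℝ≥0∞ :=
  ⨆ (es : List (Edge n)) (_ : ValidInput es) (_ : (es.length : ℝ) ≤ c * n) (F : Forest n),
    Rand.expCost (B.base es F)

/-- The subroutines of parallel Filter-Borůvka. -/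
def parSubroutines {n : ℕ} (B : ParallelMSF n) : Subroutines n where
  partition := parPartition
  filter := parFilter
  base := B.base

/-- The expected span of parallel Filter-Borůvka on a graph with weights `w`, over the random choices
of the algorithm. -/
def parExpectedSpan {n m : ℕ} (c : ℝ) (B : ParallelMSF n) (G : InputGraph n m) (w : Fin m → ℝ) :
    ℝ≥0∞ :=
  expectedCost (parSubroutines B) c (Nat.clog 2 n + 1) (G.edges w)

/-! ## Random edge weights -/

/-- The mean of `f` when the weights `w 0, …, w (m - 1)` are assigned to the `m` edges by a uniformly
random permutation. -/
def randomWeightMean {m : ℕ} (w : Fin m → ℝ) (f : (Fin m → ℝ) → ℝ≥0∞) : ℝ≥0∞ :=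
  (∑ σ : Equiv.Perm (Fin m), f fun i => w (σ i)) / (m.factorial : ℝ≥0∞)

end FilterBoruvka

end

/-!
# The expected cost of Filter-Borůvka

Under a uniformly random assignment of the weights, a call of the recursion with a given set of
edges sees every order of these edges equally often, and this stays true for both recursive calls.
Given the set `L` of light edges, the orders of `L` and of the other edges are still uniform. The
first recursive call depends on the order of `L` only, and its result determines which of the heavy
edges survive the filter, so that the survivors are again in uniformly random order. This is
expressed by finite weight functions on the permutations that are invariant under permuting the
edges of a call (`Exchangeable`); conditioning on an event amounts to restricting such a weight
function, and no normalization is needed (`sum_expCost_afterSplit_le`).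

A heavy edge survives the filter only if the light edges separate its ends. If `L` has `k` of `N`
edges, then a heavy edge `i` with this property is a bridge of `L ∪ {i}`. By exchangeability, `i`
may be replaced by a random edge of a random set of `k + 1` edges, and such a set has at most `n`
bridges, as incidence vectors of bridges are linearly independent (`card_bridges_le`). So at most
`n * (N - k) / (k + 1)` survivors are expected (`sum_card_crossing_le`). For `N > c * n > 3 * n` and
`N / 3 ≤ k ≤ 2 * N / 3`, this is at most `2 * n`, and the light edges together with the survivors
are fewer than `N` by a constant factor. Hence the work that is linear in the number of edges sums
to `O(m)`, while the expected number of base cases is `O(log (2 + m / n))`: the light call loses a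
constant factor of its edges, and the heavy call has `O(1)` base cases in expectation. Both
effects are collected in one potential function (`exists_potential_affine`). At least one fourth of
the pivots are balanced (`length_le_four_mul_balanced`), so that a constant number of partitioning
passes is expected. The induction is `costBound_filterRec`.

It remains to analyse the subroutines (`Implements`). For the correctness of the filter it suffices
that the base case merges the ends of its edges. In the sequential algorithm, a Borůvka round halves
the number of active vertices, because each root with an edge lies on a 2-cycle of lightest edges,
and weights decrease along the paths to the roots, so that pointer doubling ends at the roots
(`boruvkaRound_spec`). In the parallel algorithm, the work of a level has span `O(log m)`, which is
`O(log n)` since the graph is simple, and the loop that stores the representatives makes the base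
case span at least `log n`.
-/

namespace FilterBoruvka

/-! ### Expected cost of randomized programs -/

/-- The mean of `g` under `p`. -/
noncomputable def mean {α : Type} (p : PMF α) (g : α → ℝ≥0∞) : ℝ≥0∞ := ∑' a, p a * g a

section Mean

variable {α β : Type}

lemma mean_pure (a : α) (g : α → ℝ≥0∞) : mean (PMF.pure a) g = g a := by
  unfold mean
  rw [tsum_eq_single a]
  · simp
  · intro b hb
    simp [PMF.pure_apply, hb]

lemma mean_bind (p : PMF α) (f : α → PMF β) (g : β → ℝ≥0∞) :
    mean (p.bind f) g = mean p fun a => mean (f a) g := by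
  unfold mean
  simp only [PMF.bind_apply, ← ENNReal.tsum_mul_right, ← ENNReal.tsum_mul_left]
  rw [ENNReal.tsum_comm]
  simp only [mul_assoc]

lemma mean_map (p : PMF α) (f : α → β) (g : β → ℝ≥0∞) :
    mean (p.map f) g = mean p fun a => g (f a) := by
  rw [← PMF.bind_pure_comp, mean_bind]
  simp [mean_pure]

lemma mean_mono (p : PMF α) {g h : α → ℝ≥0∞} (H : ∀ a, p a ≠ 0 → g a ≤ h a) :
    mean p g ≤ mean p h := by
  refine ENNReal.tsum_le_tsum fun a => ?_
  by_cases ha : p a = 0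
  · simp [ha]
  · gcongr
    exact H a ha

lemma mean_const (p : PMF α) (x : ℝ≥0∞) : mean p (fun _ => x) = x := by
  unfold mean
  rw [ENNReal.tsum_mul_right, p.tsum_coe, one_mul]

lemma mean_add (p : PMF α) (g h : α → ℝ≥0∞) :
    mean p (fun a => g a + h a) = mean p g + mean p h := by
  unfold mean
  simp only [mul_add, ENNReal.tsum_add]

lemma mean_uniform [Fintype α] [Nonempty α] (g : α → ℝ≥0∞) :
    mean (PMF.uniformOfFintype α) g = (∑ a, g a) / Fintype.card α := by
  unfold mean
  rw [tsum_fintype]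
  simp only [PMF.uniformOfFintype_apply]
  rw [← Finset.mul_sum, mul_comm, ENNReal.div_eq_inv_mul, mul_comm]

end Mean

section Rand

variable {α β : Type}

/-- The mean of a function of the outcome and the cost of a randomized program. -/
noncomputable def Rand.mean (x : Rand α) (g : Option α × ℕ → ℝ≥0∞) : ℝ≥0∞ :=
  FilterBoruvka.mean (α := Option α × ℕ) x g

/-- The probability of an outcome. -/
noncomputable def Rand.prob (x : Rand α) (r : Option α × ℕ) : ℝ≥0∞ :=
  (show PMF (Option α × ℕ) from x) r

lemma Rand.expCost_eq_mean (x : Rand α) : x.expCost = x.mean fun r => (r.2 : ℝ≥0∞) := rfl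

lemma Rand.tsum_prob (x : Rand α) : ∑' r, x.prob r = 1 := PMF.tsum_coe _

/-- The contribution of an intermediate outcome `r` to a mean after the continuation `f`. -/
noncomputable def contMean (f : α → Rand β) (g : Option β × ℕ → ℝ≥0∞) :
    Option α × ℕ → ℝ≥0∞
  | (none, t) => g (none, t)
  | (some a, t) => (f a).mean fun s => g (s.1, t + s.2)

lemma Rand.mean_bind (x : Rand α) (f : α → Rand β) (g : Option β × ℕ → ℝ≥0∞) :
    (x >>= f).mean g = x.mean (contMean f g) := by
  refine (FilterBoruvka.mean_bind _ _ _).trans ?_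
  unfold Rand.mean
  congr 1
  funext r
  match r with
  | (none, t) => exact mean_pure _ _
  | (some a, t) => exact mean_map _ _ _

lemma Rand.mean_lift (x : Timed α) (g : Option α × ℕ → ℝ≥0∞) :
    (Rand.lift x).mean g = g (some x.val, x.cost) := mean_pure _ _

lemma Rand.mean_of_pure (a : α) (g : Option α × ℕ → ℝ≥0∞) :
    (pure a : Rand α).mean g = g (some a, 0) := mean_pure _ _

lemma Rand.mean_interrupt (g : Option α × ℕ → ℝ≥0∞) :
    (Rand.interrupt : Rand α).mean g = g (none, 0) := mean_pure _ _

/-- The value of `f` at the outcome of a program, and `0` after an interruption. -/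
noncomputable def onSome (f : α → ℝ≥0∞) : Option α → ℝ≥0∞
  | none => 0
  | some a => f a

lemma Rand.expCost_bind (x : Rand α) (f : α → Rand β) :
    (x >>= f).expCost = x.expCost + x.mean fun r => onSome (fun a => (f a).expCost) r.1 := by
  rw [Rand.expCost_eq_mean, Rand.mean_bind, Rand.expCost_eq_mean]
  refine Eq.trans ?_ (FilterBoruvka.mean_add _ _ _)
  unfold Rand.mean
  congr 1
  funext r
  match r with
  | (none, t) => simp [contMean, onSome]
  | (some a, t) =>
    simp only [contMean, onSome, Nat.cast_add]
    refine (FilterBoruvka.mean_add _ _ _).trans ?_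
    exact congrArg (· + (f a).expCost) (FilterBoruvka.mean_const _ _)

lemma Rand.expCost_lift (x : Timed α) : (Rand.lift x).expCost = x.cost := by
  rw [Rand.expCost_eq_mean, Rand.mean_lift]

lemma Rand.expCost_pure (a : α) : (pure a : Rand α).expCost = 0 := by
  rw [Rand.expCost_eq_mean, Rand.mean_of_pure]; simp

lemma Rand.expCost_interrupt : (Rand.interrupt : Rand α).expCost = 0 := by
  rw [Rand.expCost_eq_mean, Rand.mean_interrupt]; simp

lemma Rand.expCost_lift_bind (x : Timed α) (f : α → Rand β) :
    (Rand.lift x >>= f).expCost = x.cost + (f x.val).expCost := by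
  rw [Rand.expCost_bind, Rand.expCost_lift, Rand.mean_lift]; rfl

lemma Rand.expCost_interrupt_bind (f : α → Rand β) :
    ((Rand.interrupt : Rand α) >>= f).expCost = 0 := by
  rw [Rand.expCost_bind, Rand.expCost_interrupt, Rand.mean_interrupt]; simp [onSome]

lemma Rand.mean_bind_assoc {γ : Type} (x : Rand α) (f : α → Rand β) (h : β → Rand γ)
    (g : Option γ × ℕ → ℝ≥0∞) :
    ((x >>= f) >>= h).mean g = (x >>= fun a => f a >>= h).mean g := by
  simp only [Rand.mean_bind]
  congr 1
  funext r
  match r with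
  | (none, t) => rfl
  | (some a, t) =>
    simp only [contMean, Rand.mean_bind]
    congr 1
    funext s
    match s with
    | (none, t') => rfl
    | (some b, t') => simp only [contMean, add_assoc]

lemma Rand.expCost_bind_assoc {γ : Type} (x : Rand α) (f : α → Rand β) (h : β → Rand γ) :
    ((x >>= f) >>= h).expCost = (x >>= fun a => f a >>= h).expCost :=
  Rand.mean_bind_assoc x f h _

lemma Rand.expCost_pure_bind (a : α) (f : α → Rand β) :
    ((pure a : Rand α) >>= f).expCost = (f a).expCost := by
  rw [Rand.expCost_bind, Rand.expCost_pure, Rand.mean_of_pure, zero_add]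
  rfl

lemma Rand.expCost_pick_bind (l : List α) (hl : 0 < l.length) (f : α → Rand β) :
    (Rand.pick l >>= f).expCost = 1 + (l.map fun a => (f a).expCost).sum / l.length := by
  have : Nonempty (Fin l.length) := ⟨⟨0, hl⟩⟩
  have key : ∀ g : Option α × ℕ → ℝ≥0∞,
      (Rand.pick l).mean g = (l.map fun a => g (some a, 1)).sum / l.length := by
    intro g
    have hp : Rand.pick l = (show Rand α from PMF.map
        (fun i : Fin l.length => (some (l.get i), 1)) (PMF.uniformOfFintype (Fin l.length))) :=
      dif_pos hl
    rw [hp]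
    refine (mean_map _ _ _).trans ?_
    rw [mean_uniform, Fintype.card_fin, ← List.sum_ofFn]
    congr 2
    apply List.ext_getElem <;> simp
  rw [Rand.expCost_bind, Rand.expCost_eq_mean, key, key]
  simp only [onSome, Nat.cast_one, List.map_const', List.sum_replicate, nsmul_eq_mul, mul_one]
  rw [ENNReal.div_self (by simpa using hl.ne') (by simp)]

/-! ### Possible outcomes -/

/-- `a` is a possible result of the program. -/
def Rand.Possible (x : Rand α) (a : α) : Prop := ∃ t, x.prob (some a, t) ≠ 0

lemma Rand.Possible.bind {x : Rand α} {f : α → Rand β} {b : β} (h : (x >>= f).Possible b) :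
    ∃ a, x.Possible a ∧ (f a).Possible b := by
  obtain ⟨t, ht⟩ := h
  obtain ⟨⟨r, t₁⟩, hr, hb⟩ := (PMF.mem_support_bind_iff _ _ _).1 ((PMF.mem_support_iff _ _).2 ht)
  match r with
  | none =>
    simp only [PMF.support_pure, Set.mem_singleton_iff, Prod.mk.injEq] at hb
    exact absurd hb.1 (by simp)
  | some a =>
    obtain ⟨⟨s, t₂⟩, hs, he⟩ := (PMF.mem_support_map_iff _ _ _).1 hb
    simp only [Prod.mk.injEq] at he
    obtain ⟨rfl, -⟩ := he
    exact ⟨a, ⟨t₁, hr⟩, ⟨t₂, hs⟩⟩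

lemma Rand.Possible.eq_of_lift {x : Timed α} {a : α} (h : (Rand.lift x).Possible a) :
    a = x.val := by
  obtain ⟨t, ht⟩ := h
  change (PMF.pure _ : PMF (Option α × ℕ)) _ ≠ 0 at ht
  rw [← PMF.mem_support_iff, PMF.support_pure, Set.mem_singleton_iff, Prod.mk.injEq] at ht
  simpa using ht.1

lemma Rand.Possible.eq_of_pure {a b : α} (h : (pure b : Rand α).Possible a) : a = b :=
  Rand.Possible.eq_of_lift (x := ⟨b, 0⟩) h

lemma Rand.not_possible_interrupt (a : α) : ¬ (Rand.interrupt : Rand α).Possible a := by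
  rintro ⟨t, ht⟩
  change (PMF.pure _ : PMF (Option α × ℕ)) _ ≠ 0 at ht
  rw [← PMF.mem_support_iff, PMF.support_pure, Set.mem_singleton_iff, Prod.mk.injEq] at ht
  simp at ht

/-! ### Monotonicity in the bound on the recursion depth -/

/-- Functions of outcome and cost that do not decrease when an interrupted program is continued. -/
def Continuing (g : Option α × ℕ → ℝ≥0∞) : Prop :=
  ∀ t r, t ≤ r.2 → g (none, t) ≤ g r

/-- `y` behaves like `x`, except that it may go on where `x` is interrupted. -/
def Rand.Extends (x y : Rand α) : Prop := ∀ g, Continuing g → x.mean g ≤ y.mean g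

lemma Rand.Extends.rfl {x : Rand α} : x.Extends x := fun _ _ => le_rfl

lemma Rand.Extends.expCost_le {x y : Rand α} (h : x.Extends y) : x.expCost ≤ y.expCost :=
  h _ fun _ _ ht => by exact_mod_cast ht

lemma Rand.interrupt_extends (x : Rand α) : Rand.interrupt.Extends x := by
  intro g hg
  rw [Rand.mean_interrupt]
  calc g (none, 0) = x.mean fun _ => g (none, 0) := (mean_const _ _).symm
    _ ≤ x.mean g := mean_mono _ fun r _ => hg 0 r (Nat.zero_le _)

lemma Rand.Extends.bind {x y : Rand α} {f f' : α → Rand β} (h : x.Extends y)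
    (hf : ∀ a, (f a).Extends (f' a)) : (x >>= f).Extends (y >>= f') := by
  intro g hg
  rw [Rand.mean_bind, Rand.mean_bind]
  have hc : Continuing (contMean f' g) := by
    intro t r ht
    match r with
    | (none, t') => exact hg t (none, t') ht
    | (some a, t') =>
      calc g (none, t) = (f' a).mean fun _ => g (none, t) := (mean_const _ _).symm
        _ ≤ _ := mean_mono _ fun r _ => hg t _ (ht.trans (Nat.le_add_right _ _))
  refine le_trans (mean_mono _ fun r _ => ?_) (h _ hc)
  match r with
  | (none, t) => exact le_rfl
  | (some a, t) =>
    refine hf a _ fun t' r ht => hg _ _ ?_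
    exact Nat.add_le_add_left ht t

lemma splitBalanced_extends {n : ℕ} (S : Subroutines n) (es : List (Edge n)) (k : ℕ) :
    (splitBalanced S es k).Extends (splitBalanced S es (k + 1)) := by
  induction k with
  | zero => exact Rand.interrupt_extends _
  | succ k ih =>
    rw [splitBalanced, splitBalanced]
    refine Rand.Extends.rfl.bind fun e => Rand.Extends.rfl.bind fun q =>
      Rand.Extends.rfl.bind fun _ => ?_
    split_ifs
    · exact Rand.Extends.rfl
    · exact ih

lemma filterRec_extends {n : ℕ} (S : Subroutines n) (c : ℝ) (k : ℕ) (es : List (Edge n))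
    (F : Forest n) : (filterRec S c k es F).Extends (filterRec S c (k + 1) es F) := by
  induction k generalizing es F with
  | zero => exact Rand.interrupt_extends _
  | succ k ih =>
    rw [filterRec, filterRec]
    refine Rand.Extends.rfl.bind fun _ => ?_
    split_ifs
    · exact Rand.Extends.rfl
    · exact (splitBalanced_extends S es k).bind fun q => (ih _ _).bind fun F₁ =>
        Rand.Extends.rfl.bind fun heavy => ih _ _

end Rand

/-! ### Edges between components of a random sample -/

variable {n m : ℕ}

/-- The ends of the edge `i` are separated by the edges in `L`: some labelling of the vertices is
constant on each edge of `L`, but not on `i`.  This says that the ends are in different components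
of the graph with edge set `L`. -/
def Separated (ends : Fin m → Fin n × Fin n) (L : Finset (Fin m)) (i : Fin m) : Prop :=
  ∃ f : Fin n → Fin n, (∀ j ∈ L, f (ends j).1 = f (ends j).2) ∧ f (ends i).1 ≠ f (ends i).2

open Classical in
/-- A graph with `n` vertices has at most `n` bridges: the signed incidence vectors of the bridges
are linearly independent, as the indicator function of one side of a bridge is a functional that
vanishes on all other edges. -/
lemma card_bridges_le (ends : Fin m → Fin n × Fin n) (M : Finset (Fin m)) :
    (M.filter fun i => Separated ends (M.erase i) i).card ≤ n := by
  set B := M.filter fun i => Separated ends (M.erase i) i with hB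
  have h : ∀ i : B, ∃ f : Fin n → Fin n, (∀ j ∈ M.erase i, f (ends j).1 = f (ends j).2) ∧
      f (ends i).1 ≠ f (ends i).2 := fun i => (Finset.mem_filter.1 i.2).2
  choose f hf hne using h
  let v : B → (Fin n → ℚ) := fun i => Pi.single (ends i).1 1 - Pi.single (ends i).2 1
  let φ : B → Module.Dual ℚ (Fin n → ℚ) := fun i =>
    Fintype.linearCombination ℚ fun x : Fin n => if f i x = f i (ends i).1 then (1 : ℚ) else 0
  have hφ : ∀ i j, φ i (v j) = (if f i (ends j).1 = f i (ends i).1 then 1 else 0) -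
      (if f i (ends j).2 = f i (ends i).1 then 1 else 0) := by
    intro i j
    simp only [φ, v, map_sub, Fintype.linearCombination_apply_single, one_smul]
  have hv : LinearIndependent ℚ v := by
    refine LinearIndependent.of_pairwise_dual_eq_zero_one v φ ?_ ?_
    · intro i j hij
      rw [hφ, hf i j, sub_self]
      exact Finset.mem_erase.2 ⟨fun h => hij (Subtype.ext h.symm), (Finset.mem_filter.1 j.2).1⟩
    · intro i
      rw [hφ, if_pos rfl, if_neg (hne i).symm, sub_zero]
  simpa using hv.fintype_card_le_finrank

lemma Separated.mono {ends : Fin m → Fin n × Fin n} {L L' : Finset (Fin m)} {i : Fin m}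
    (h : Separated ends L i) (hL : L' ⊆ L) : Separated ends L' i := by
  obtain ⟨f, hf, hi⟩ := h
  exact ⟨f, fun j hj => hf j (hL hj), hi⟩

/-- A weight function on the assignments `σ` of weights to edges that does not change when the
weights of the edges in `A` are permuted.  Up to normalization this is a law of `σ` under which,
conditionally on the weights outside `A`, all orders of the edges in `A` are equally likely. -/
def Exchangeable (μ : Equiv.Perm (Fin m) → ℝ≥0∞) (A : Finset (Fin m)) : Prop :=
  ∀ τ : Equiv.Perm (Fin m), (∀ i ∉ A, τ i = i) → ∀ σ, μ (σ * τ) = μ σ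

/-- The edges in `A` with weight at most `t` under the assignment `σ`. -/
noncomputable def lightSet (w : Fin m → ℝ) (t : ℝ) (A : Finset (Fin m))
    (σ : Equiv.Perm (Fin m)) : Finset (Fin m) :=
  A.filter fun i => w (σ i) ≤ t

open Classical in
/-- The edges in `A` outside `L` whose ends are separated by `L`. -/
noncomputable def crossing (ends : Fin m → Fin n × Fin n) (A L : Finset (Fin m)) :
    Finset (Fin m) :=
  (A \ L).filter (Separated ends L)

lemma mem_lightSet {w : Fin m → ℝ} {t : ℝ} {A : Finset (Fin m)} {σ : Equiv.Perm (Fin m)}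
    {i : Fin m} : i ∈ lightSet w t A σ ↔ i ∈ A ∧ w (σ i) ≤ t := by
  simp [lightSet]

lemma lightSet_subset (w : Fin m → ℝ) (t : ℝ) (A : Finset (Fin m)) (σ : Equiv.Perm (Fin m)) :
    lightSet w t A σ ⊆ A := Finset.filter_subset _ _

lemma mem_of_fixes {A : Finset (Fin m)} {τ : Equiv.Perm (Fin m)} (hτ : ∀ i ∉ A, τ i = i)
    {i : Fin m} : τ i ∈ A ↔ i ∈ A := by
  constructor
  · intro h
    by_contra hi
    exact hi (hτ i hi ▸ h)
  · intro h
    by_contra hi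
    have := hτ _ hi
    exact hi (by rwa [τ.injective this])

lemma mem_lightSet_mul {w : Fin m → ℝ} {t : ℝ} {A : Finset (Fin m)} {σ τ : Equiv.Perm (Fin m)}
    (hτ : ∀ i ∉ A, τ i = i) {i : Fin m} :
    i ∈ lightSet w t A (σ * τ) ↔ τ i ∈ lightSet w t A σ := by
  simp [mem_lightSet, mem_of_fixes hτ]

open Classical in
/-- In expectation, a random sample `L` of `A` separates the ends of at most
`n * |A \ L| / (|L| + 1)` of the other edges.  If `i` is such an edge, then `i` is a bridge of
`L ∪ {i}`; exchanging `i` with a uniformly random edge of `L ∪ {i}` turns this into the event that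
a uniformly random edge of a set of `|L| + 1` edges is a bridge. -/
lemma sum_card_crossing_le (ends : Fin m → Fin n × Fin n) (w : Fin m → ℝ) (t : ℝ)
    (A : Finset (Fin m)) (μ : Equiv.Perm (Fin m) → ℝ≥0∞) (hμ : Exchangeable μ A) :
    ∑ σ, μ σ * ((crossing ends A (lightSet w t A σ)).card * ((lightSet w t A σ).card + 1)) ≤
      ∑ σ, μ σ * (n * (A \ lightSet w t A σ).card) := by
  set L := lightSet w t A with hL
  let X : Equiv.Perm (Fin m) → Fin m → Fin m → ℝ≥0∞ := fun σ i j =>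
    if i ∈ crossing ends A (L σ) ∧ j ∈ insert i (L σ) then μ σ else 0
  let Y : Equiv.Perm (Fin m) → Fin m → Fin m → ℝ≥0∞ := fun σ i j =>
    if j ∈ A \ L σ ∧ i ∈ insert j (L σ) ∧ Separated ends ((insert j (L σ)).erase i) i
      then μ σ else 0
  have h1 : ∀ σ, μ σ * ((crossing ends A (L σ)).card * ((L σ).card + 1)) =
      ∑ i, ∑ j, X σ i j := by
    intro σ
    have : ∀ i, ∑ j, X σ i j =
        if i ∈ crossing ends A (L σ) then μ σ * ((L σ).card + 1) else 0 := by
      intro i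
      split_ifs with hi
      · have hiL : i ∉ L σ := (Finset.mem_sdiff.1 (Finset.mem_filter.1 hi).1).2
        simp only [X, hi, true_and]
        rw [← Finset.sum_filter, Finset.sum_const, Finset.filter_univ_mem,
          Finset.card_insert_of_notMem hiL, nsmul_eq_mul, mul_comm]
        push_cast
        rfl
      · simp [X, hi]
    simp only [this]
    rw [← Finset.sum_filter, Finset.sum_const, Finset.filter_univ_mem, nsmul_eq_mul]
    ring
  have h2 : ∀ σ, ∑ i, ∑ j, Y σ i j ≤ μ σ * (n * (A \ L σ).card) := by
    intro σ
    rw [Finset.sum_comm]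
    have : ∀ j, ∑ i, Y σ i j ≤ if j ∈ A \ L σ then μ σ * n else 0 := by
      intro j
      split_ifs with hj
      · simp only [Y, hj, true_and]
        rw [← Finset.sum_filter, Finset.sum_const, nsmul_eq_mul, mul_comm]
        gcongr
        refine le_trans (le_of_eq ?_) (card_bridges_le ends (insert j (L σ)))
        congr 1
        ext i
        simp
      · simp only [Y, hj, false_and, if_false, Finset.sum_const_zero, le_refl]
    refine (Finset.sum_le_sum fun j _ => this j).trans (le_of_eq ?_)
    rw [← Finset.sum_filter, Finset.sum_const, Finset.filter_univ_mem, nsmul_eq_mul]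
    ring
  have h3 : ∀ i j, ∑ σ, X σ i j ≤ ∑ σ, Y σ i j := by
    intro i j
    rw [← Equiv.sum_comp (Equiv.mulRight (Equiv.swap i j))]
    refine Finset.sum_le_sum fun σ _ => ?_
    simp only [Equiv.coe_mulRight, X]
    split_ifs with h
    · obtain ⟨hi, hj⟩ := h
      obtain ⟨hiA, hsep⟩ := Finset.mem_filter.1 hi
      obtain ⟨hiA, hiL⟩ := Finset.mem_sdiff.1 hiA
      have hjA : j ∈ A := by
        rcases Finset.mem_insert.1 hj with rfl | hj
        · exact hiA
        · exact lightSet_subset _ _ _ _ hj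
      have hτ : ∀ x ∉ A, Equiv.swap i j x = x := fun x hx =>
        Equiv.swap_apply_of_ne_of_ne (fun h => hx (h ▸ hiA)) (fun h => hx (h ▸ hjA))
      have hmem : ∀ x, x ∈ L (σ * Equiv.swap i j) ↔ Equiv.swap i j x ∈ L σ := fun x =>
        mem_lightSet_mul hτ
      rw [hμ _ hτ]
      simp only [Y]
      rw [if_pos]
      refine ⟨Finset.mem_sdiff.2 ⟨hjA, ?_⟩, ?_, hsep.mono ?_⟩
      · rwa [hmem, Equiv.swap_apply_left] at hiL
      · rcases Finset.mem_insert.1 hj with rfl | hj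
        · exact Finset.mem_insert_self _ _
        · rw [hmem, Equiv.swap_apply_right] at hj
          exact Finset.mem_insert_of_mem hj
      · intro x hx
        obtain ⟨hxi, hx⟩ := Finset.mem_erase.1 hx
        by_cases hxj : x = j
        · subst hxj
          exact (Finset.mem_insert.1 hj).resolve_left hxi
        · rw [hmem, Equiv.swap_apply_of_ne_of_ne hxi hxj]
          exact (Finset.mem_insert.1 hx).resolve_left hxj
    · exact zero_le
  calc _ = ∑ σ, ∑ i, ∑ j, X σ i j := Finset.sum_congr rfl fun σ _ => h1 σ
    _ = ∑ i, ∑ j, ∑ σ, X σ i j := by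
      rw [Finset.sum_comm]
      exact Finset.sum_congr rfl fun i _ => Finset.sum_comm
    _ ≤ ∑ i, ∑ j, ∑ σ, Y σ i j :=
      Finset.sum_le_sum fun i _ => Finset.sum_le_sum fun j _ => h3 i j
    _ = ∑ σ, ∑ i, ∑ j, Y σ i j := by
      exact (Finset.sum_congr rfl fun i _ => Finset.sum_comm).trans Finset.sum_comm
    _ ≤ _ := Finset.sum_le_sum fun σ _ => h2 σ

/-! ### The potential function -/

/-- A bound on the expected number of base cases for `N` edges.  It jumps at the threshold `c * n`
because a call slightly above the threshold already has two base cases. -/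
noncomputable def baseCount (c : ℝ) (n N : ℕ) : ℝ :=
  if (N : ℝ) ≤ c * n then 1 else 3 + 30 * Real.log (N / (c * n))

lemma one_le_baseCount {c : ℝ} (hc : 3 < c) (n N : ℕ) : 1 ≤ baseCount c n N := by
  unfold baseCount
  split_ifs with h
  · exact le_rfl
  · rcases n.eq_zero_or_pos with rfl | hn
    · simp
    have hcn : 0 < c * n := by positivity
    have : 0 ≤ Real.log (N / (c * n)) :=
      Real.log_nonneg ((one_le_div hcn).2 (not_le.1 h).le)
    linarith

lemma log_le_div_exp_one {x : ℝ} (hx : 0 < x) : Real.log x ≤ x / Real.exp 1 := by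
  have h := Real.log_le_sub_one_of_pos (div_pos hx (Real.exp_pos 1))
  rw [Real.log_div hx.ne' (Real.exp_pos 1).ne', Real.log_exp] at h
  linarith

/-- The number of base cases is bounded by an affine function of the number `h` of edges that
survive the filter, with slope `s`.  The inequality leaves room for one more base case and for the
mean of `h`, which is at most `2 * n`. -/
lemma exists_baseCount_affine {c : ℝ} (hc : 3 < c) {n N k : ℕ} (hn : 0 < n)
    (hN : c * n < N) (hk : N ≤ 3 * k) (hk' : 3 * k ≤ 2 * N) :
    ∃ s : ℝ, 0 ≤ s ∧ (∀ h : ℕ, h + k ≤ N → baseCount c n h ≤ 1 + s * (h / (c * n))) ∧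
      1 + baseCount c n k + s * (2 / c) ≤ baseCount c n N := by
  have hn' : (0 : ℝ) < n := by exact_mod_cast hn
  have hcn : 0 < c * n := by positivity
  have hkN : (N : ℝ) ≤ 3 * k := by exact_mod_cast hk
  have hkN' : 3 * (k : ℝ) ≤ 2 * N := by exact_mod_cast hk'
  have hNpos : (0 : ℝ) < N := hcn.trans hN
  have hkpos : (0 : ℝ) < k := by linarith
  have hgN : baseCount c n N = 3 + 30 * Real.log (N / (c * n)) := if_neg (not_le.2 hN)
  have hlogN : 0 ≤ Real.log (N / (c * n)) := Real.log_nonneg ((one_le_div hcn).2 hN.le)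
  by_cases hsmall : 2 * (N : ℝ) ≤ 3 * (c * n)
  · -- below `3 / 2` times the threshold both recursive calls are base cases
    refine ⟨0, le_rfl, fun h hh => ?_, ?_⟩
    · have hh' : (h : ℝ) + k ≤ N := by exact_mod_cast hh
      rw [baseCount, if_pos (by linarith)]
      simp
    · rw [hgN, baseCount, if_pos (by linarith)]
      linarith
  · push Not at hsmall
    have he := Real.exp_one_gt_d9
    have hepos := Real.exp_pos 1
    -- the slope of an affine majorant of the jump by `2` and of `30 * log x ≤ 30 * x / e` for `1 ≤ x`
    refine ⟨2 + 30 / Real.exp 1, by positivity, fun h _ => ?_, ?_⟩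
    · have hx0 : (0 : ℝ) ≤ h / (c * n) := by positivity
      unfold baseCount
      split_ifs with hh
      · have : 0 ≤ (2 + 30 / Real.exp 1) * (h / (c * n)) := by positivity
        linarith
      · have hx : 1 < (h : ℝ) / (c * n) := (one_lt_div hcn).2 (not_le.1 hh)
        have hl := log_le_div_exp_one (zero_lt_one.trans hx)
        have : (2 + 30 / Real.exp 1) * ((h : ℝ) / (c * n)) =
            2 * (h / (c * n)) + 30 * (h / (c * n) / Real.exp 1) := by ring
        rw [this]
        linarith
    · have hs : (2 + 30 / Real.exp 1) * (2 / c) ≤ 9 := by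
        have h1 : 30 / Real.exp 1 ≤ 11.1 := by
          rw [div_le_iff₀ hepos]
          linarith
        have h2 : 2 / c ≤ 2 / 3 := by gcongr
        calc (2 + 30 / Real.exp 1) * (2 / c) ≤ (2 + 11.1) * (2 / 3) := by gcongr
          _ ≤ 9 := by norm_num
      have hlog : (1 : ℝ) / 3 ≤ Real.log (3 / 2) := by
        have := Real.one_sub_inv_le_log_of_pos (show (0 : ℝ) < 3 / 2 by norm_num)
        norm_num at this ⊢
        linarith
      -- the light call has at most two thirds of the edges, which gains `30 * log (3 / 2)`
      rw [hgN]
      unfold baseCount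
      split_ifs with hkc
      · have : Real.log (3 / 2) ≤ Real.log (N / (c * n)) := by
          apply Real.log_le_log (by norm_num)
          rw [le_div_iff₀ hcn]
          linarith
        linarith
      · have : Real.log (3 / 2) + Real.log (k / (c * n)) ≤ Real.log (N / (c * n)) := by
          rw [← Real.log_mul (by norm_num) (by positivity)]
          apply Real.log_le_log (by positivity)
          rw [← mul_div_assoc]
          gcongr
          linarith
        linarith

/-- A bound on the expected cost of a recursive call with `N` edges, when a base case costs at most
`s₁` and the other work of a call with `N` edges costs at most `d₀ + d₁ * N`. -/
noncomputable def potential (c s₁ d₀ d₁ : ℝ) (n N : ℕ) : ℝ :=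
  3 * c * d₁ / (c - 3) * N + (s₁ + d₀) * baseCount c n N - d₀

lemma le_potential {c s₁ d₀ d₁ : ℝ} (hc : 3 < c) (hs : 0 ≤ s₁) (h₀ : 0 ≤ d₀) (h₁ : 0 ≤ d₁)
    (n N : ℕ) : s₁ ≤ potential c s₁ d₀ d₁ n N := by
  have h := one_le_baseCount hc n N
  have h3 : 0 < c - 3 := by linarith
  have h2 : 0 ≤ 3 * c * d₁ / (c - 3) * N := by positivity
  have := mul_le_mul_of_nonneg_left h (add_nonneg hs h₀)
  unfold potential
  linarith

/-- The recurrence of the expected cost.  The condition `3 < c` enters here: the light edges and the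
filtered heavy edges are together fewer than all edges by a constant factor. -/
lemma exists_potential_affine {c s₁ d₀ d₁ : ℝ} (hc : 3 < c) (hs : 0 ≤ s₁) (h₀ : 0 ≤ d₀)
    (h₁ : 0 ≤ d₁) {n N k : ℕ} (hn : 0 < n) (hN : c * n < N) (hk : N ≤ 3 * k)
    (hk' : 3 * k ≤ 2 * N) :
    ∃ α β : ℝ, 0 ≤ α ∧ 0 ≤ β ∧
      (∀ h : ℕ, h + k ≤ N → potential c s₁ d₀ d₁ n h ≤ α + β * h) ∧
      d₀ + d₁ * N + potential c s₁ d₀ d₁ n k + α + β * (n * (N - k) / (k + 1)) ≤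
        potential c s₁ d₀ d₁ n N := by
  obtain ⟨s, hs0, haff, hstep⟩ := exists_baseCount_affine hc hn hN hk hk'
  have hn' : (0 : ℝ) < n := by exact_mod_cast hn
  have hcn : 0 < c * n := by positivity
  have hkN : (N : ℝ) ≤ 3 * k := by exact_mod_cast hk
  have hkN' : 3 * (k : ℝ) ≤ 2 * N := by exact_mod_cast hk'
  have hNpos : (0 : ℝ) < N := hcn.trans hN
  have hkpos : (0 : ℝ) < k := by linarith
  have hc0 : 0 < c := by linarith
  have hc3 : 0 < c - 3 := by linarith
  set a := 3 * c * d₁ / (c - 3) with ha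
  have ha0 : 0 ≤ a := by positivity
  set H := (n : ℝ) * (N - k) / (k + 1) with hH
  have hNk : 0 ≤ (N : ℝ) - k := by linarith
  have hH2 : H ≤ 2 * n := by
    rw [hH, div_le_iff₀ (by positivity)]
    nlinarith
  have hH3 : c * H ≤ 3 * (N - k) := by
    rw [hH, mul_div_assoc', div_le_iff₀ (by positivity)]
    have : c * n ≤ 3 * (k + 1) := by linarith
    calc c * (n * ((N : ℝ) - k)) = (c * n) * (N - k) := by ring
      _ ≤ (3 * (k + 1)) * (N - k) := by gcongr
      _ = _ := by ring
  refine ⟨s₁, a + (s₁ + d₀) * (s / (c * n)), hs, by positivity, fun h hh => ?_, ?_⟩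
  · have := mul_le_mul_of_nonneg_left (haff h hh) (add_nonneg hs h₀)
    unfold potential
    rw [← ha]
    have e : (s₁ + d₀) * (1 + s * (h / (c * n))) =
      s₁ + d₀ + (s₁ + d₀) * (s / (c * n)) * h := by ring
    linarith
  · have e1 : s / (c * n) * H ≤ s * (2 / c) := by
      calc s / (c * n) * H ≤ s / (c * n) * (2 * n) := by gcongr
        _ = s * (2 / c) := by field_simp
    have e2 : d₁ * N + a * H ≤ a * (N - k) := by
      have e3 : a * (c - 3) = 3 * c * d₁ := by
        rw [ha]
        field_simp
      have e4 : a * (c * H) ≤ a * (3 * (N - k)) := by gcongr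
      have e5 : (3 * c * d₁) * N ≤ (3 * c * d₁) * (3 * (N - k)) := by
        gcongr
        linarith
      rw [← e3] at e5
      have e6 : c * (d₁ * N + a * H) ≤ c * (a * (N - k)) := by
        nlinarith
      exact le_of_mul_le_mul_left e6 hc0
    have e7 := mul_le_mul_of_nonneg_left hstep (add_nonneg hs h₀)
    have e8 := mul_le_mul_of_nonneg_left e1 (add_nonneg hs h₀)
    unfold potential
    rw [← ha]
    nlinarith

/-! ### Representatives -/

/-- `P` maps vertices to representatives, and the ends of the edges are representatives. -/
def IsRepMap (P : Fin n → Fin n) (es : List (Edge n)) : Prop :=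
  (∀ v, P (P v) = P v) ∧ ∀ e ∈ es, P e.src = e.src ∧ P e.dst = e.dst

/-- The array `Q` of representatives is coarser than `P` and merges the ends of each edge. -/
def Merges (P : Fin n → Fin n) (es : List (Edge n)) (Q : Fin n → Fin n) : Prop :=
  (∀ v, Q (Q v) = Q v) ∧ (∀ v, Q (P v) = Q v) ∧ ∀ e ∈ es, Q e.src = Q e.dst

/-- Replace the ends of an edge by their representatives. -/
def Edge.relabel (P : Fin n → Fin n) (e : Edge n) : Edge n := ⟨P e.src, P e.dst, e.wt, e.tag⟩

/-- The edges that remain after filtering, with representatives as ends. -/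
def contract (P : Fin n → Fin n) (es : List (Edge n)) : List (Edge n) :=
  (es.map (Edge.relabel P)).filter fun e => e.src ≠ e.dst

/-- A sequence in its order or in reversed order. -/
def arrange {α : Type} (r : Bool) (l : List α) : List α := if r then l.reverse else l

lemma mem_arrange {α : Type} {r : Bool} {l : List α} {a : α} : a ∈ arrange r l ↔ a ∈ l := by
  cases r <;> simp [arrange]

lemma arrange_perm {α : Type} (r : Bool) (l : List α) : (arrange r l).Perm l := by
  cases r <;> simp [arrange, List.reverse_perm]

lemma length_arrange {α : Type} (r : Bool) (l : List α) : (arrange r l).length = l.length :=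
  (arrange_perm r l).length_eq

lemma arrange_map {α β : Type} (r : Bool) (f : α → β) (l : List α) :
    (arrange r l).map f = arrange r (l.map f) := by
  cases r <;> simp [arrange]

lemma ValidInput.sublist {es es' : List (Edge n)} (h : ValidInput es) (hs : es'.Sublist es) :
    ValidInput es' :=
  ⟨fun e he => h.1 e (hs.subset he), h.2.1.sublist (hs.map _), h.2.2.sublist (hs.map _)⟩

lemma ValidInput.perm {es es' : List (Edge n)} (h : ValidInput es) (hs : es'.Perm es) :
    ValidInput es' :=
  ⟨fun e he => h.1 e (hs.subset he), ((hs.map _).nodup_iff).2 h.2.1,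
    ((hs.map _).nodup_iff).2 h.2.2⟩

lemma ValidInput.contract {es : List (Edge n)} (h : ValidInput es) (P : Fin n → Fin n) :
    ValidInput (contract P es) := by
  refine ⟨fun e he => by simpa using (List.mem_filter.1 he).2, ?_, ?_⟩
  · refine List.Nodup.sublist (List.filter_sublist.map _) ?_
    rw [List.map_map]
    exact h.2.1
  · refine List.Nodup.sublist (List.filter_sublist.map _) ?_
    rw [List.map_map]
    exact h.2.2

lemma IsRepMap.subset {P : Fin n → Fin n} {es es' : List (Edge n)} (h : IsRepMap P es)
    (hs : es' ⊆ es) : IsRepMap P es' := ⟨h.1, fun e he => h.2 e (hs he)⟩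

lemma Merges.subset {P Q : Fin n → Fin n} {es es' : List (Edge n)} (h : Merges P es Q)
    (hs : es' ⊆ es) : Merges P es' Q := ⟨h.1, h.2.1, fun e he => h.2.2 e (hs he)⟩

lemma mem_contract {P : Fin n → Fin n} {es : List (Edge n)} {e : Edge n} :
    e ∈ contract P es ↔ ∃ e' ∈ es, e'.relabel P = e ∧ P e'.src ≠ P e'.dst := by
  unfold contract
  rw [List.mem_filter, List.mem_map]
  constructor
  · rintro ⟨⟨e', he', rfl⟩, h⟩
    exact ⟨e', he', rfl, of_decide_eq_true h⟩
  · rintro ⟨e', he', rfl, h⟩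
    exact ⟨⟨e', he', rfl⟩, decide_eq_true h⟩

lemma isRepMap_contract {P : Fin n → Fin n} (hP : ∀ v, P (P v) = P v) (es : List (Edge n)) :
    IsRepMap P (contract P es) := by
  refine ⟨hP, fun e he => ?_⟩
  obtain ⟨e', -, rfl, -⟩ := mem_contract.1 he
  exact ⟨hP _, hP _⟩

/-- Merging in two stages: first some edges, and then what is left of others. -/
lemma Merges.trans {P Q R : Fin n → Fin n} {es es' : List (Edge n)} (h : Merges P es Q)
    (h' : Merges Q (contract Q es') R) : Merges P (es ++ es') R := by
  refine ⟨h'.1, fun v => ?_, fun e he => ?_⟩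
  · rw [← h'.2.1 (P v), h.2.1, h'.2.1]
  · rw [← h'.2.1 e.src, ← h'.2.1 e.dst]
    rcases List.mem_append.1 he with he | he
    · rw [h.2.2 e he]
    · by_cases hq : Q e.src = Q e.dst
      · rw [hq]
      · exact h'.2.2 _ (mem_contract.2 ⟨e, he, rfl, hq⟩)

/-! ### The subroutines -/

/-- What the analysis of the recursion needs to know about the subroutines: their results up to the
order of sequences, bounds `pc` and `fc` on the costs of partitioning and filtering in terms of the
number of edges, and a bound `s` on the expected cost of the base case. -/
structure Implements (S : Subroutines n) (c : ℝ) (r : Bool) (pc fc : ℕ → ℕ) (s : ℝ) : Prop where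
  partition_val : ∀ t es, (S.partition t es).val =
    (arrange r (es.filter fun e => e.wt ≤ t), arrange r (es.filter fun e => t < e.wt))
  partition_cost : ∀ t es, (S.partition t es).cost ≤ pc es.length
  filter_val : ∀ P es, (S.filter P es).val = arrange r (contract P es)
  filter_cost : ∀ P es, (S.filter P es).cost ≤ fc es.length
  base_cost : ∀ es F, ValidInput es → (es.length : ℝ) ≤ c * n → IsRepMap F.P es →
    (S.base es F).expCost ≤ ENNReal.ofReal s
  base_merges : ∀ es F F', ValidInput es → IsRepMap F.P es → (S.base es F).Possible F' →
    Merges F.P es F'.P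

section Correctness

variable {S : Subroutines n} {c : ℝ} {r : Bool} {pc fc : ℕ → ℕ} {s : ℝ}

lemma splitBalanced_possible {es : List (Edge n)} {k : ℕ} {q : List (Edge n) × List (Edge n)}
    (h : (splitBalanced S es k).Possible q) : ∃ t, q = (S.partition t es).val := by
  induction k with
  | zero => exact absurd h (Rand.not_possible_interrupt _)
  | succ k ih =>
    rw [splitBalanced] at h
    obtain ⟨e, -, h⟩ := h.bind
    obtain ⟨q', hq', h⟩ := h.bind
    obtain ⟨_, -, h⟩ := h.bind
    split_ifs at h
    · exact ⟨e.wt, by rw [h.eq_of_pure, hq'.eq_of_lift]⟩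
    · exact ih h

/-- The representatives after a recursive call merge the ends of all its edges. -/
lemma filterRec_merges (hS : Implements S c r pc fc s) (k : ℕ) (es : List (Edge n))
    (F F' : Forest n) (hv : ValidInput es) (hF : IsRepMap F.P es)
    (h : (filterRec S c k es F).Possible F') : Merges F.P es F'.P := by
  induction k generalizing es F F' with
  | zero => exact absurd h (Rand.not_possible_interrupt _)
  | succ k ih =>
    rw [filterRec] at h
    obtain ⟨_, -, h⟩ := h.bind
    split_ifs at h
    · exact hS.base_merges es F F' hv hF h
    · obtain ⟨q, hq, h⟩ := h.bind
      obtain ⟨F₁, h₁, h⟩ := h.bind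
      obtain ⟨heavy, hh, h⟩ := h.bind
      obtain ⟨t, rfl⟩ := splitBalanced_possible hq
      have hh := hh.eq_of_lift
      rw [hS.filter_val] at hh
      subst hh
      rw [hS.partition_val] at h₁ h
      have hlo := (hv.sublist (List.filter_sublist (p := fun e => e.wt ≤ t))).perm
        (arrange_perm r _)
      have hhi := (hv.sublist (List.filter_sublist (p := fun e => t < e.wt))).perm
        (arrange_perm r _)
      have m₁ := ih _ _ _ hlo (hF.subset (List.Subset.trans (arrange_perm r _).subset
        List.filter_sublist.subset)) h₁
      have m₂ := ih _ _ _ ((hhi.contract F₁.P).perm (arrange_perm r _))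
        ((isRepMap_contract m₁.1 _).subset (arrange_perm r _).subset) h
      refine (m₁.trans (m₂.subset (arrange_perm r _).symm.subset)).subset fun e he => ?_
      rw [List.mem_append, mem_arrange, mem_arrange, List.mem_filter, List.mem_filter]
      rcases le_or_gt e.wt t with h | h
      · exact Or.inl ⟨he, by simpa using h⟩
      · exact Or.inr ⟨he, by simpa using h⟩

end Correctness

/-! ### Balanced pivots -/

/-- Both parts of the partition at `t` have at least one third of the edges. -/
def Balanced (es : List (Edge n)) (t : ℝ) : Prop :=
  es.length ≤ 3 * (es.filter fun e => e.wt ≤ t).length ∧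
    es.length ≤ 3 * (es.filter fun e => t < e.wt).length

noncomputable instance (es : List (Edge n)) (t : ℝ) : Decidable (Balanced es t) := by
  unfold Balanced
  infer_instance

lemma length_filter_add (es : List (Edge n)) (t : ℝ) :
    (es.filter fun e => e.wt ≤ t).length + (es.filter fun e => t < e.wt).length = es.length := by
  have := es.length_eq_length_filter_add (fun e => decide (e.wt ≤ t))
  rw [this]
  congr 2
  apply List.filter_congr
  intro e _
  by_cases h : e.wt ≤ t
  · simp [h, not_lt.2 h]
  · simp [h, not_le.1 h]

/-- The rank of a weight determines the weight of an edge. -/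
lemma wt_le_of_rank_le {es : List (Edge n)} {e f : Edge n} (hf : f ∈ es)
    (h : (es.filter fun g => g.wt ≤ f.wt).length ≤ (es.filter fun g => g.wt ≤ e.wt).length) :
    f.wt ≤ e.wt := by
  by_contra hlt
  push Not at hlt
  have hs : (es.filter fun g => g.wt ≤ e.wt).Sublist (es.filter fun g => g.wt ≤ f.wt) :=
    List.monotone_filter_right es fun g hg => by
      simp only [decide_eq_true_eq] at hg ⊢
      exact hg.trans hlt.le
  have heq := hs.eq_of_length_le h
  have : f ∈ es.filter fun g => g.wt ≤ e.wt := by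
    rw [heq]
    simp [hf]
  simp only [List.mem_filter, decide_eq_true_eq] at this
  exact absurd this.2 (not_le.2 hlt)

/-- At least one fourth of the pivots are balanced. -/
lemma length_le_four_mul_balanced {es : List (Edge n)} (hw : (es.map Edge.wt).Nodup)
    (h4 : 4 ≤ es.length) :
    es.length ≤ 4 * (es.filter fun e => Balanced es e.wt).length := by
  set N := es.length with hN
  set ρ : Edge n → ℕ := fun e => (es.filter fun g => g.wt ≤ e.wt).length with hρ
  have hsum := es.length_eq_length_filter_add (fun e => decide (Balanced es e.wt))
  set bad := es.filter fun e => !decide (Balanced es e.wt) with hbad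
  have hnd : (bad.map ρ).Nodup := by
    refine List.Nodup.map_on ?_ ((hw.of_map).filter _)
    intro e he f hf hef
    have he := (List.mem_filter.1 he).1
    have hf := (List.mem_filter.1 hf).1
    exact List.inj_on_of_nodup_map hw he hf
      (le_antisymm (wt_le_of_rank_le he hef.le) (wt_le_of_rank_le hf hef.ge))
  -- the ranks of unbalanced pivots are the lowest and the highest ones
  have hsub : (bad.map ρ).toFinset ⊆
      Finset.Icc 1 ((N - 1) / 3) ∪ Finset.Icc (N - (N - 1) / 3) N := by
    intro x hx
    simp only [List.mem_toFinset, List.mem_map] at hx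
    obtain ⟨e, he, rfl⟩ := hx
    obtain ⟨he, hb⟩ := List.mem_filter.1 he
    have hb : ¬ Balanced es e.wt := by simpa using hb
    unfold Balanced at hb
    have h1 := length_filter_add es e.wt
    have h2 : 0 < ρ e := List.length_pos_of_mem (a := e) (by simp [he])
    change ρ e + _ = N at h1
    change ¬ (N ≤ 3 * ρ e ∧ _) at hb
    simp only [Finset.mem_union, Finset.mem_Icc]
    omega
  have hcard : bad.length ≤ (N - 1) / 3 + (N + 1 - (N - (N - 1) / 3)) := by
    calc bad.length = (bad.map ρ).toFinset.card := by
          rw [List.toFinset_card_of_nodup hnd, List.length_map]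
      _ ≤ _ := (Finset.card_le_card hsub).trans (Finset.card_union_le _ _)
      _ = _ := by simp
  omega

lemma sum_map_ite_add {α : Type} (l : List α) (p : α → Prop) [DecidablePred p] (f : α → ℝ≥0∞)
    (q z : ℝ≥0∞) :
    (l.map fun a => q + if p a then f a else z).sum =
      l.length * q + (l.map fun a => if p a then f a else 0).sum +
        (l.filter fun a => ¬ p a).length * z := by
  induction l with
  | nil => simp
  | cons a l ih =>
    simp only [List.map_cons, List.sum_cons, List.length_cons, ih, List.filter_cons]
    by_cases h : p a
    · simp only [h, if_true, not_true_eq_false, decide_false, Bool.false_eq_true, if_false]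
      push_cast
      ring
    · simp only [h, if_false, not_false_eq_true, decide_true, if_true, List.length_cons]
      push_cast
      ring

/-- The expected cost of pivot selection, partitioning and the continuation `f`: at most four
repetitions are expected, and the final pivot is uniformly random among the balanced ones. -/
lemma expCost_splitBalanced_bind_le {α : Type} {S : Subroutines n} {c : ℝ} {r : Bool}
    {pc fc : ℕ → ℕ} {s : ℝ} (hS : Implements S c r pc fc s) {es : List (Edge n)}
    (hw : (es.map Edge.wt).Nodup) (h4 : 4 ≤ es.length)
    (f : List (Edge n) × List (Edge n) → Rand α) (k : ℕ) :
    (splitBalanced S es k >>= f).expCost ≤ 4 * ((pc es.length + 2 : ℕ) : ℝ≥0∞) +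
      (es.map fun e => if Balanced es e.wt then (f (S.partition e.wt es).val).expCost else 0).sum /
        (es.filter fun e => Balanced es e.wt).length := by
  have hb := length_le_four_mul_balanced hw h4
  have hsum := es.length_eq_length_filter_add (fun e => decide (Balanced es e.wt))
  set N := es.length with hN
  set b := (es.filter fun e => Balanced es e.wt).length with hbdef
  set Z := (es.map fun e =>
    if Balanced es e.wt then (f (S.partition e.wt es).val).expCost else 0).sum with hZ
  set Q : ℝ≥0∞ := ((pc N + 2 : ℕ) : ℝ≥0∞) with hQ
  have hb0 : (b : ℝ≥0∞) ≠ 0 := by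
    have : b ≠ 0 := by omega
    exact_mod_cast this
  have hN0 : (N : ℝ≥0∞) ≠ 0 := by
    have : N ≠ 0 := by omega
    exact_mod_cast this
  induction k with
  | zero =>
    rw [splitBalanced, Rand.expCost_interrupt_bind]
    exact zero_le
  | succ k ih =>
    set U := (splitBalanced S es k >>= f).expCost with hU
    rw [splitBalanced, Rand.expCost_bind_assoc, Rand.expCost_pick_bind es (by omega)]
    have step : ∀ e : Edge n,
        ((do
          let q ← Rand.lift (S.partition e.wt es)
          Rand.lift (tick 1)
          if es.length ≤ 3 * q.1.length ∧ es.length ≤ 3 * q.2.length then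
            pure q
          else
            splitBalanced S es k : Rand _) >>= f).expCost ≤
          ((pc N + 1 : ℕ) : ℝ≥0∞) + if Balanced es e.wt then
            (f (S.partition e.wt es).val).expCost else U := by
      intro e
      rw [Rand.expCost_bind_assoc, Rand.expCost_lift_bind, Rand.expCost_bind_assoc,
        Rand.expCost_lift_bind, ← add_assoc]
      have h1 : ((S.partition e.wt es).cost : ℝ≥0∞) + ((tick 1).cost : ℝ≥0∞) ≤
          ((pc N + 1 : ℕ) : ℝ≥0∞) := by
        have := hS.partition_cost e.wt es
        change _ + ((1 : ℕ) : ℝ≥0∞) ≤ _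
        exact_mod_cast Nat.add_le_add_right this 1
      refine add_le_add h1 (le_of_eq ?_)
      have h2 : Balanced es e.wt ↔ es.length ≤ 3 * (S.partition e.wt es).val.1.length ∧
          es.length ≤ 3 * (S.partition e.wt es).val.2.length := by
        rw [hS.partition_val, length_arrange, length_arrange]
        rfl
      by_cases h : Balanced es e.wt
      · rw [if_pos h, if_pos (h2.1 h), Rand.expCost_pure_bind]
      · rw [if_neg h, if_neg (fun h' => h (h2.2 h'))]
    have hle : (es.map fun e => ((do
          let q ← Rand.lift (S.partition e.wt es)
          Rand.lift (tick 1)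
          if es.length ≤ 3 * q.1.length ∧ es.length ≤ 3 * q.2.length then
            pure q
          else
            splitBalanced S es k : Rand _) >>= f).expCost).sum ≤
        N * ((pc N + 1 : ℕ) : ℝ≥0∞) + Z + (es.filter fun e => ¬ Balanced es e.wt).length * U := by
      refine (List.sum_le_sum fun e _ => step e).trans (le_of_eq ?_)
      exact sum_map_ite_add es (fun e => Balanced es e.wt) _ _ _
    have hbad : (es.filter fun e => ¬ Balanced es e.wt).length + b = N := by
      rw [hsum, add_comm]
      congr 2
      apply List.filter_congr
      simp
    set d := (es.filter fun e => ¬ Balanced es e.wt).length with hd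
    refine (add_le_add le_rfl (ENNReal.div_le_div_right hle _)).trans ?_
    -- `4 * Q + Z / b` is preserved by the recurrence, as a repetition has probability `d / N ≤ 3 / 4`
    have hdN : 4 * d ≤ 3 * N := by omega
    have hZb : Z = b * (Z / b) := (ENNReal.mul_div_cancel hb0 (by simp)).symm
    have key : (N : ℝ≥0∞) * 1 + (N * ((pc N + 1 : ℕ) : ℝ≥0∞) + Z + d * U) ≤
        N * (4 * Q + Z / b) := by
      calc (N : ℝ≥0∞) * 1 + (N * ((pc N + 1 : ℕ) : ℝ≥0∞) + Z + d * U)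
          ≤ N * 1 + (N * ((pc N + 1 : ℕ) : ℝ≥0∞) + Z + d * (4 * Q + Z / b)) := by gcongr
        _ = N * Q + Z + d * (4 * Q + Z / b) := by
          rw [hQ]
          push_cast
          ring
        _ = N * Q + b * (Z / b) + d * (4 * Q + Z / b) := by rw [← hZb]
        _ = N * Q + ((4 * d : ℕ) : ℝ≥0∞) * Q + ((d + b : ℕ) : ℝ≥0∞) * (Z / b) := by
          push_cast
          ring
        _ ≤ N * Q + ((3 * N : ℕ) : ℝ≥0∞) * Q + (N : ℝ≥0∞) * (Z / b) := by
          rw [hbad]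
          gcongr
        _ = N * (4 * Q + Z / b) := by
          push_cast
          ring
    calc 1 + (N * ((pc N + 1 : ℕ) : ℝ≥0∞) + Z + d * U) / N
        = (N * 1 + (N * ((pc N + 1 : ℕ) : ℝ≥0∞) + Z + d * U)) / N := by
          rw [ENNReal.add_div (a := (N : ℝ≥0∞) * 1), mul_one, ENNReal.div_self hN0 (by simp)]
      _ ≤ N * (4 * Q + Z / b) / N := ENNReal.div_le_div_right key _
      _ = 4 * Q + Z / b := by
        rw [mul_comm, ENNReal.mul_div_cancel_right hN0 (by simp)]

/-! ### The expected cost of the recursion -/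

/-- The edge sequence with indices `l`, ends `ends` and weights `u`. -/
def edgeList (ends : Fin m → Fin n × Fin n) (u : Fin m → ℝ) (l : List (Fin m)) : List (Edge n) :=
  l.map fun i => ⟨(ends i).1, (ends i).2, u i, i⟩

section EdgeList

variable (ends : Fin m → Fin n × Fin n) (u : Fin m → ℝ) (l : List (Fin m))

lemma length_edgeList : (edgeList ends u l).length = l.length := List.length_map _

lemma edgeList_filter (p : Edge n → Bool) :
    (edgeList ends u l).filter p =
      edgeList ends u (l.filter fun i => p ⟨(ends i).1, (ends i).2, u i, i⟩) := by
  unfold edgeList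
  rw [List.filter_map]
  rfl

lemma arrange_edgeList (r : Bool) :
    arrange r (edgeList ends u l) = edgeList ends u (arrange r l) :=
  (arrange_map r _ l).symm

/-- Filtering removes indices and changes the ends, independently of the weights. -/
lemma contract_edgeList (P : Fin n → Fin n) :
    contract P (edgeList ends u l) = edgeList (fun i => (P (ends i).1, P (ends i).2)) u
      (l.filter fun i => P (ends i).1 ≠ P (ends i).2) := by
  unfold contract edgeList
  rw [List.map_map, List.filter_map]
  rfl

lemma validInput_edgeList (hl : l.Nodup) (hloop : ∀ i ∈ l, (ends i).1 ≠ (ends i).2)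
    (hu : Function.Injective u) : ValidInput (edgeList ends u l) := by
  refine ⟨fun e he => ?_, ?_, ?_⟩
  · obtain ⟨i, hi, rfl⟩ := List.mem_map.1 he
    exact hloop i hi
  · unfold edgeList
    rw [List.map_map]
    exact hl.map hu
  · unfold edgeList
    rw [List.map_map]
    exact hl.map Fin.val_injective

lemma isRepMap_edgeList {P : Fin n → Fin n} :
    IsRepMap P (edgeList ends u l) ↔ (∀ v, P (P v) = P v) ∧
      ∀ i ∈ l, P (ends i).1 = (ends i).1 ∧ P (ends i).2 = (ends i).2 := by
  simp [IsRepMap, edgeList]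

end EdgeList

lemma lightSet_mul_eq_iff {w : Fin m → ℝ} {t : ℝ} {A L : Finset (Fin m)}
    {σ τ : Equiv.Perm (Fin m)} (hτ : ∀ i ∉ A, τ i = i) (hL : ∀ i, τ i ∈ L ↔ i ∈ L) :
    lightSet w t A (σ * τ) = L ↔ lightSet w t A σ = L := by
  simp only [Finset.ext_iff, mem_lightSet_mul hτ]
  constructor
  · intro h i
    obtain ⟨j, rfl⟩ := τ.surjective i
    rw [h, hL]
  · intro h i
    rw [h, hL]

lemma card_lightSet_mul {w : Fin m → ℝ} {t : ℝ} {A : Finset (Fin m)}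
    {σ τ : Equiv.Perm (Fin m)} (hτ : ∀ i ∉ A, τ i = i) :
    (lightSet w t A (σ * τ)).card = (lightSet w t A σ).card := by
  refine Finset.card_bij (fun i _ => τ i) (fun i hi => (mem_lightSet_mul hτ).1 hi)
    (fun i _ j _ h => τ.injective h) fun j hj => ⟨τ⁻¹ j, ?_, by simp⟩
  rw [mem_lightSet_mul hτ]
  simpa using hj

/-- A bound on a sum over assignments follows from bounds under each value of `key`. -/
lemma sum_le_of_fibers {κ : Type} [DecidableEq κ] (μ X : Equiv.Perm (Fin m) → ℝ≥0∞)
    (key : Equiv.Perm (Fin m) → κ) (Φ : κ → ℝ≥0∞)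
    (h : ∀ σ₀, ∑ σ, (if key σ = key σ₀ then μ σ else 0) * X σ ≤
      Φ (key σ₀) * ∑ σ, if key σ = key σ₀ then μ σ else 0) :
    ∑ σ, μ σ * X σ ≤ ∑ σ, μ σ * Φ (key σ) := by
  rw [← Finset.sum_fiberwise_of_maps_to (t := Finset.univ.image key) (g := key)
      (fun σ _ => Finset.mem_image_of_mem _ (Finset.mem_univ σ)),
    ← Finset.sum_fiberwise_of_maps_to (t := Finset.univ.image key) (g := key)
      (f := fun σ => μ σ * Φ (key σ))
      (fun σ _ => Finset.mem_image_of_mem _ (Finset.mem_univ σ))]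
  refine Finset.sum_le_sum fun x hx => ?_
  obtain ⟨σ₀, -, rfl⟩ := Finset.mem_image.1 hx
  rw [Finset.sum_filter, Finset.sum_filter]
  refine le_trans (le_of_eq ?_) ((h σ₀).trans (le_of_eq ?_))
  · exact Finset.sum_congr rfl fun σ _ => by split_ifs <;> simp
  · rw [Finset.mul_sum]
    refine Finset.sum_congr rfl fun σ _ => ?_
    split_ifs with hσ
    · rw [hσ, mul_comm]
    · simp

section Recursion

variable {S : Subroutines n} {c : ℝ} {r : Bool} {pc fc : ℕ → ℕ} {s d₀ d₁ : ℝ} {w : Fin m → ℝ}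

/-- The claim of the induction on the recursion depth: under exchangeable assignments of weights to
the edges of a call, the expected cost of the call is at most the potential. -/
def CostBound (S : Subroutines n) (c : ℝ) (w : Fin m → ℝ) (φ : ℕ → ℝ) (k : ℕ) : Prop :=
  ∀ (ends : Fin m → Fin n × Fin n) (l : List (Fin m)) (F : Forest n)
    (μ : Equiv.Perm (Fin m) → ℝ≥0∞), l.Nodup → (∀ i ∈ l, (ends i).1 ≠ (ends i).2) →
    (∀ v, F.P (F.P v) = F.P v) →
    (∀ i ∈ l, F.P (ends i).1 = (ends i).1 ∧ F.P (ends i).2 = (ends i).2) →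
    Exchangeable μ l.toFinset →
    ∑ σ, μ σ * (filterRec S c k (edgeList ends (fun i => w (σ i)) l) F).expCost ≤
      ENNReal.ofReal (φ l.length) * ∑ σ, μ σ

/-- The part of a call after partitioning. -/
noncomputable def afterSplit (S : Subroutines n) (c : ℝ) (k : ℕ) (F : Forest n)
    (q : List (Edge n) × List (Edge n)) : Rand (Forest n) := do
  let F₁ ← filterRec S c k q.1 F
  let heavy ← Rand.lift (S.filter F₁.P q.2)
  filterRec S c k heavy F₁

/-- The cost after partitioning, when the set `L` of light edges is given.  The weights within `L`
and within the rest of the edges are still exchangeable.  The result of the first recursive call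
depends on the weights in `L` only, so that the second recursive call, whose edges are determined
by this result, also has exchangeable weights. -/
lemma sum_expCost_afterSplit_le (hS : Implements S c r pc fc s) (hfc : Monotone fc)
    (hw : Function.Injective w) {φ : ℕ → ℝ} {k : ℕ} (ih : CostBound S c w φ k)
    {ends : Fin m → Fin n × Fin n} {l : List (Fin m)} {F : Forest n}
    {μ : Equiv.Perm (Fin m) → ℝ≥0∞} (hl : l.Nodup) (hloop : ∀ i ∈ l, (ends i).1 ≠ (ends i).2)
    (hF : ∀ v, F.P (F.P v) = F.P v)
    (hFl : ∀ i ∈ l, F.P (ends i).1 = (ends i).1 ∧ F.P (ends i).2 = (ends i).2)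
    (L : Finset (Fin m)) (hLl : L ⊆ l.toFinset)
    (hμ : ∀ τ : Equiv.Perm (Fin m), (∀ i ∉ l.toFinset, τ i = i) → (∀ i, τ i ∈ L ↔ i ∈ L) →
      ∀ σ, μ (σ * τ) = μ σ)
    {α β : ℝ} (hα : 0 ≤ α) (hβ : 0 ≤ β)
    (hφ : ∀ h : ℕ, h + L.card ≤ l.length → φ h ≤ α + β * h) :
    ∑ σ, μ σ * (afterSplit S c k F
        (edgeList ends (fun i => w (σ i)) (arrange r (l.filter fun i => i ∈ L)),
          edgeList ends (fun i => w (σ i)) (arrange r (l.filter fun i => i ∉ L)))).expCost ≤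
      (ENNReal.ofReal (φ L.card) + fc l.length +
        (ENNReal.ofReal α + ENNReal.ofReal β * (crossing ends l.toFinset L).card)) *
          ∑ σ, μ σ := by
  classical
  set lo := arrange r (l.filter fun i => i ∈ L) with hlo
  set hi := arrange r (l.filter fun i => i ∉ L) with hhi
  have hlo_mem : ∀ i, i ∈ lo ↔ i ∈ L := fun i => by
    rw [hlo, mem_arrange, List.mem_filter]
    simp only [decide_eq_true_eq, and_iff_right_iff_imp]
    exact fun h => List.mem_toFinset.1 (hLl h)
  have hhi_mem : ∀ i, i ∈ hi ↔ i ∈ l ∧ i ∉ L := fun i => by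
    rw [hhi, mem_arrange, List.mem_filter]
    simp
  have hlo_nd : lo.Nodup := (arrange_perm r _).nodup_iff.2 (hl.filter _)
  have hhi_nd : hi.Nodup := (arrange_perm r _).nodup_iff.2 (hl.filter _)
  have hlo_fin : lo.toFinset = L := by ext i; simp [hlo_mem]
  have hlo_len : lo.length = L.card := by rw [← hlo_fin, List.toFinset_card_of_nodup hlo_nd]
  have hhi_len : hi.length + L.card = l.length := by
    rw [← hlo_len, hlo, hhi, length_arrange, length_arrange,
      l.length_eq_length_filter_add (fun i => decide (i ∈ L)), add_comm]
    congr 2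
    apply List.filter_congr
    simp
  have hlo_sub : ∀ i ∈ lo, i ∈ l := fun i hi => List.mem_toFinset.1 (hLl ((hlo_mem i).1 hi))
  set light : Equiv.Perm (Fin m) → Rand (Forest n) := fun σ =>
    filterRec S c k (edgeList ends (fun i => w (σ i)) lo) F with hlight
  -- the cost of the light call
  have h1 : ∑ σ, μ σ * (light σ).expCost ≤ ENNReal.ofReal (φ L.card) * ∑ σ, μ σ := by
    rw [← hlo_len]
    refine ih ends lo F μ hlo_nd (fun i hi => hloop i (hlo_sub i hi)) hF
      (fun i hi => hFl i (hlo_sub i hi)) ?_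
    rw [hlo_fin]
    intro τ hτ
    exact hμ τ (fun i hi => hτ i fun h => hi (hLl h)) fun i => mem_of_fixes hτ
  -- the cost of filtering and of the heavy call, for a given outcome of the light call
  set rest : Equiv.Perm (Fin m) → Forest n → ℝ≥0∞ := fun σ F₁ =>
    (Rand.lift (S.filter F₁.P (edgeList ends (fun i => w (σ i)) hi)) >>= fun heavy =>
      filterRec S c k heavy F₁).expCost with hrest
  set b : ℝ≥0∞ := fc l.length +
    (ENNReal.ofReal α + ENNReal.ofReal β * (crossing ends l.toFinset L).card) with hb
  have h2 : ∀ x : Option (Forest n) × ℕ,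
      ∑ σ, μ σ * (light σ).prob x * onSome (rest σ) x.1 ≤ b * ∑ σ, μ σ * (light σ).prob x := by
    rintro ⟨_ | F₁, t⟩
    · simp [onSome]
    by_cases hz : ∀ σ, μ σ * (light σ).prob (some F₁, t) = 0
    · simp [hz]
    push Not at hz
    obtain ⟨σ₀, hσ₀⟩ := hz
    have hmer : Merges F.P (edgeList ends (fun i => w (σ₀ i)) lo) F₁.P := by
      refine filterRec_merges hS k _ F F₁ ?_ ?_ ⟨t, right_ne_zero_of_mul hσ₀⟩
      · exact validInput_edgeList _ _ _ hlo_nd (fun i hi => hloop i (hlo_sub i hi))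
          (hw.comp σ₀.injective)
      · exact (isRepMap_edgeList _ _ _).2 ⟨hF, fun i hi => hFl i (hlo_sub i hi)⟩
    set l' := arrange r (hi.filter fun i => F₁.P (ends i).1 ≠ F₁.P (ends i).2) with hl'
    have hl'_mem : ∀ i, i ∈ l' ↔ i ∈ hi ∧ F₁.P (ends i).1 ≠ F₁.P (ends i).2 := fun i => by
      rw [hl', mem_arrange, List.mem_filter]
      simp
    have hl'_nd : l'.Nodup := (arrange_perm r _).nodup_iff.2 (hhi_nd.filter _)
    have hl'_le : l'.length ≤ hi.length := by
      rw [hl', length_arrange]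
      exact List.length_filter_le _ _
    have hl'_cross : l'.length ≤ (crossing ends l.toFinset L).card := by
      rw [← List.toFinset_card_of_nodup hl'_nd]
      refine Finset.card_le_card fun i hi => ?_
      obtain ⟨hi, hne⟩ := (hl'_mem i).1 (List.mem_toFinset.1 hi)
      obtain ⟨hil, hiL⟩ := (hhi_mem i).1 hi
      refine Finset.mem_filter.2 ⟨Finset.mem_sdiff.2 ⟨List.mem_toFinset.2 hil, hiL⟩,
        F₁.P, fun j hj => ?_, hne⟩
      exact hmer.2.2 ⟨_, _, w (σ₀ j), j⟩ (List.mem_map.2 ⟨j, (hlo_mem j).2 hj, rfl⟩)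
    have hν : ∀ τ : Equiv.Perm (Fin m), (∀ i ∉ l'.toFinset, τ i = i) → ∀ σ,
        μ (σ * τ) * (light (σ * τ)).prob (some F₁, t) = μ σ * (light σ).prob (some F₁, t) := by
      intro τ hτ σ
      have hτL : ∀ i ∈ L, τ i = i := fun i hiL => hτ i fun hi' =>
        ((hhi_mem i).1 ((hl'_mem i).1 (List.mem_toFinset.1 hi')).1).2 hiL
      have hlt : light (σ * τ) = light σ := by
        simp only [hlight, edgeList]
        congr 1
        refine List.map_congr_left fun i hi => ?_
        rw [Equiv.Perm.mul_apply, hτL i ((hlo_mem i).1 hi)]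
      rw [hlt, hμ τ (fun i hi' => hτ i fun h => hi' ?_) fun i => ?_]
      · exact List.mem_toFinset.2
          ((hhi_mem i).1 ((hl'_mem i).1 (List.mem_toFinset.1 h)).1).1
      · constructor
        · intro h
          have := hτL _ h
          rwa [τ.injective this] at h
        · intro h
          rwa [hτL i h]
    have hih := ih (fun i => (F₁.P (ends i).1, F₁.P (ends i).2)) l' F₁
      (fun σ => μ σ * (light σ).prob (some F₁, t)) hl'_nd (fun i hi => ((hl'_mem i).1 hi).2)
      hmer.1 (fun i _ => ⟨hmer.1 _, hmer.1 _⟩) hν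
    have hbound : ENNReal.ofReal (φ l'.length) ≤
        ENNReal.ofReal α + ENNReal.ofReal β * (crossing ends l.toFinset L).card := by
      rw [← ENNReal.ofReal_natCast, ← ENNReal.ofReal_mul hβ, ← ENNReal.ofReal_add hα (by positivity)]
      refine ENNReal.ofReal_le_ofReal ((hφ _ (by omega)).trans ?_)
      gcongr
    calc ∑ σ, μ σ * (light σ).prob (some F₁, t) * rest σ F₁
        ≤ ∑ σ, μ σ * (light σ).prob (some F₁, t) * (fc l.length +
          (filterRec S c k (edgeList (fun i => (F₁.P (ends i).1, F₁.P (ends i).2))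
            (fun i => w (σ i)) l') F₁).expCost) := by
          gcongr with σ
          simp only [hrest]
          rw [Rand.expCost_lift_bind, hS.filter_val, contract_edgeList, arrange_edgeList]
          gcongr
          refine (hS.filter_cost _ _).trans (hfc ?_)
          rw [length_edgeList]
          omega
      _ = fc l.length * ∑ σ, μ σ * (light σ).prob (some F₁, t) +
          ∑ σ, μ σ * (light σ).prob (some F₁, t) *
            (filterRec S c k (edgeList (fun i => (F₁.P (ends i).1, F₁.P (ends i).2))
              (fun i => w (σ i)) l') F₁).expCost := by
          simp only [mul_add, Finset.sum_add_distrib]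
          rw [Finset.mul_sum]
          congr 1
          exact Finset.sum_congr rfl fun σ _ => mul_comm _ _
      _ ≤ fc l.length * ∑ σ, μ σ * (light σ).prob (some F₁, t) +
          (ENNReal.ofReal α + ENNReal.ofReal β * (crossing ends l.toFinset L).card) *
            ∑ σ, μ σ * (light σ).prob (some F₁, t) := by
          gcongr
          exact hih.trans (mul_le_mul_left hbound _)
      _ = b * ∑ σ, μ σ * (light σ).prob (some F₁, t) := by rw [hb]; ring
  -- summation over the outcomes of the light call
  have h3 : ∑ σ, μ σ * (light σ).mean (fun x => onSome (rest σ) x.1) ≤ b * ∑ σ, μ σ := by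
    have e1 : ∀ σ, μ σ * (light σ).mean (fun x => onSome (rest σ) x.1) =
        ∑' x, μ σ * (light σ).prob x * onSome (rest σ) x.1 := by
      intro σ
      simp only [mul_assoc]
      rw [ENNReal.tsum_mul_left]
      rfl
    have e2 : ∀ σ, ∑' x, μ σ * (light σ).prob x = μ σ := by
      intro σ
      rw [ENNReal.tsum_mul_left, Rand.tsum_prob, mul_one]
    calc ∑ σ, μ σ * (light σ).mean (fun x => onSome (rest σ) x.1)
        = ∑' x, ∑ σ, μ σ * (light σ).prob x * onSome (rest σ) x.1 := by
          simp only [e1]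
          exact (Summable.tsum_finsetSum fun _ _ => ENNReal.summable).symm
      _ ≤ ∑' x, b * ∑ σ, μ σ * (light σ).prob x := ENNReal.tsum_le_tsum h2
      _ = b * ∑ σ, ∑' x, μ σ * (light σ).prob x := by
          rw [ENNReal.tsum_mul_left]
          congr 1
          exact Summable.tsum_finsetSum fun _ _ => ENNReal.summable
      _ = b * ∑ σ, μ σ := by simp only [e2]
  calc _ = ∑ σ, (μ σ * (light σ).expCost +
        μ σ * (light σ).mean (fun x => onSome (rest σ) x.1)) := by
        refine Finset.sum_congr rfl fun σ _ => ?_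
        rw [← mul_add]
        congr 1
        exact Rand.expCost_bind _ _
    _ ≤ ENNReal.ofReal (φ L.card) * ∑ σ, μ σ + b * ∑ σ, μ σ := by
        rw [Finset.sum_add_distrib]
        exact add_le_add h1 h3
    _ = _ := by
        rw [← add_mul, hb]
        ring

lemma light_edgeList (ends : Fin m → Fin n × Fin n) (l : List (Fin m)) (t : ℝ)
    (σ : Equiv.Perm (Fin m)) :
    (edgeList ends (fun i => w (σ i)) l).filter (fun e => e.wt ≤ t) =
      edgeList ends (fun i => w (σ i)) (l.filter fun i => i ∈ lightSet w t l.toFinset σ) := by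
  rw [edgeList_filter]
  congr 1
  refine List.filter_congr fun i hi => ?_
  simp [mem_lightSet, hi]

lemma heavy_edgeList (ends : Fin m → Fin n × Fin n) (l : List (Fin m)) (t : ℝ)
    (σ : Equiv.Perm (Fin m)) :
    (edgeList ends (fun i => w (σ i)) l).filter (fun e => t < e.wt) =
      edgeList ends (fun i => w (σ i)) (l.filter fun i => i ∉ lightSet w t l.toFinset σ) := by
  rw [edgeList_filter]
  congr 1
  refine List.filter_congr fun i hi => ?_
  simp [mem_lightSet, hi]

lemma length_filter_mem {l : List (Fin m)} (hl : l.Nodup) {L : Finset (Fin m)}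
    (hL : L ⊆ l.toFinset) : (l.filter fun i => i ∈ L).length = L.card := by
  rw [← List.toFinset_card_of_nodup (hl.filter _)]
  congr 1
  ext i
  simp only [List.toFinset_filter, Finset.mem_filter, List.mem_toFinset, decide_eq_true_eq,
    and_iff_right_iff_imp]
  exact fun h => List.mem_toFinset.1 (hL h)

lemma balanced_edgeList {ends : Fin m → Fin n × Fin n} {l : List (Fin m)} (hl : l.Nodup) {t : ℝ}
    {σ : Equiv.Perm (Fin m)} : Balanced (edgeList ends (fun i => w (σ i)) l) t ↔
      l.length ≤ 3 * (lightSet w t l.toFinset σ).card ∧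
        3 * (lightSet w t l.toFinset σ).card ≤ 2 * l.length := by
  have h1 := length_filter_add (edgeList ends (fun i => w (σ i)) l) t
  unfold Balanced
  rw [light_edgeList, length_edgeList, length_edgeList,
    length_filter_mem hl (lightSet_subset _ _ _ _)] at h1
  rw [light_edgeList, length_edgeList, length_edgeList,
    length_filter_mem hl (lightSet_subset _ _ _ _)]
  omega

/-- The cost of a call with a fixed balanced pivot weight `t`. The constant `9 + 4 * pc N` accounts
for the first step of the call and for the four expected rounds of pivot selection, each with the
cost of partitioning and two more steps. -/
lemma sum_expCost_pivot_le (hS : Implements S c r pc fc s) (hc : 3 < c) (hs : 0 ≤ s)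
    (h₀ : 0 ≤ d₀) (h₁ : 0 ≤ d₁) (hfc : Monotone fc)
    (hd : ∀ N ≤ m, ((9 + 4 * pc N + fc N : ℕ) : ℝ) ≤ d₀ + d₁ * N)
    (hw : Function.Injective w) {k : ℕ} (hn : 0 < n)
    (ih : CostBound S c w (potential c (s + 1) d₀ d₁ n) k)
    {ends : Fin m → Fin n × Fin n} {l : List (Fin m)} {F : Forest n}
    {μ : Equiv.Perm (Fin m) → ℝ≥0∞} (hl : l.Nodup) (hloop : ∀ i ∈ l, (ends i).1 ≠ (ends i).2)
    (hF : ∀ v, F.P (F.P v) = F.P v)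
    (hFl : ∀ i ∈ l, F.P (ends i).1 = (ends i).1 ∧ F.P (ends i).2 = (ends i).2)
    (hμ : Exchangeable μ l.toFinset) (hN : c * n < l.length) (t : ℝ)
    (hbal : ∀ σ, μ σ ≠ 0 → Balanced (edgeList ends (fun i => w (σ i)) l) t) :
    ((9 + 4 * pc l.length : ℕ) : ℝ≥0∞) * ∑ σ, μ σ +
      ∑ σ, μ σ * (afterSplit S c k F
        (S.partition t (edgeList ends (fun i => w (σ i)) l)).val).expCost ≤
      ENNReal.ofReal (potential c (s + 1) d₀ d₁ n l.length) * ∑ σ, μ σ := by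
  set N := l.length with hNdef
  set φ := potential c (s + 1) d₀ d₁ n with hφdef
  set A := l.toFinset with hA
  have hAcard : A.card = N := List.toFinset_card_of_nodup hl
  have hNm : N ≤ m := by
    rw [← hAcard]
    exact (Finset.card_le_univ _).trans (by simp)
  have hφ0 : ∀ N, 0 ≤ φ N := fun N =>
    (by linarith : 0 ≤ s + 1).trans (le_potential hc (by linarith) h₀ h₁ n N)
  set X : Equiv.Perm (Fin m) → ℝ≥0∞ := fun σ => ((9 + 4 * pc N : ℕ) : ℝ≥0∞) +
    (afterSplit S c k F (S.partition t (edgeList ends (fun i => w (σ i)) l)).val).expCost with hX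
  have hgoal : ∑ σ, μ σ * X σ ≤ ∑ σ, μ σ * ENNReal.ofReal (φ N) := by
    -- it suffices to consider the assignments with a given number of light edges
    refine sum_le_of_fibers μ X (fun σ => (lightSet w t A σ).card)
      (fun _ => ENNReal.ofReal (φ N)) fun σ₁ => ?_
    set q := (lightSet w t A σ₁).card with hq
    set ν : Equiv.Perm (Fin m) → ℝ≥0∞ := fun σ =>
      if (lightSet w t A σ).card = q then μ σ else 0 with hν
    have hνx : Exchangeable ν A := by
      intro τ hτ σ
      simp only [hν, card_lightSet_mul hτ, hμ τ hτ]
    have hνq : ∀ σ, ν σ ≠ 0 → (lightSet w t A σ).card = q := by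
      intro σ h
      by_contra hne
      exact h (if_neg hne)
    by_cases hz : ∀ σ, ν σ = 0
    · have : ∀ σ, (if (lightSet w t A σ).card = q then μ σ else 0) = 0 := hz
      simp [this]
    push Not at hz
    obtain ⟨σ₂, hσ₂⟩ := hz
    have hb2 : N ≤ 3 * q ∧ 3 * q ≤ 2 * N := by
      have h := (balanced_edgeList hl).1 (hbal σ₂ fun h => hσ₂ (by simp [hν, h]))
      rwa [hνq σ₂ hσ₂] at h
    obtain ⟨α, β, hα, hβ, haff, hstep⟩ :=
      exists_potential_affine (s₁ := s + 1) hc (by linarith) h₀ h₁ hn hN hb2.1 hb2.2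
    -- the bound for a given set of light edges
    have hfib : ∑ σ, ν σ * X σ ≤ ∑ σ, ν σ * (((9 + 4 * pc N : ℕ) : ℝ≥0∞) +
        (ENNReal.ofReal (φ q) + fc N + (ENNReal.ofReal α + ENNReal.ofReal β *
          (crossing ends A (lightSet w t A σ)).card))) := by
      refine sum_le_of_fibers ν X (lightSet w t A) (fun L => ((9 + 4 * pc N : ℕ) : ℝ≥0∞) +
        (ENNReal.ofReal (φ q) + fc N + (ENNReal.ofReal α + ENNReal.ofReal β *
          (crossing ends A L).card))) fun σ₃ => ?_
      set L := lightSet w t A σ₃ with hL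
      have hLA : L ⊆ A := lightSet_subset _ _ _ _
      set ρ : Equiv.Perm (Fin m) → ℝ≥0∞ := fun σ =>
        if lightSet w t A σ = L then ν σ else 0 with hρ
      by_cases hz : ∀ σ, ρ σ = 0
      · have : ∀ σ, (if lightSet w t A σ = L then ν σ else 0) = 0 := hz
        simp [this]
      push Not at hz
      obtain ⟨σ₄, hσ₄⟩ := hz
      have hLq : L.card = q := by
        by_cases h : lightSet w t A σ₄ = L
        · rw [← h]
          exact hνq _ fun h' => hσ₄ (by simp [hρ, h'])
        · exact absurd (if_neg h) hσ₄
      have hmain := sum_expCost_afterSplit_le (μ := ρ) hS hfc hw ih hl hloop hF hFl L hLA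
        (fun τ hτ hτL σ => by
          have hiff : lightSet w t A (σ * τ) = L ↔ lightSet w t A σ = L :=
            lightSet_mul_eq_iff hτ hτL
          simp only [hρ, hνx τ hτ]
          by_cases h : lightSet w t A σ = L
          · rw [if_pos h, if_pos (hiff.2 h)]
          · rw [if_neg h, if_neg fun h' => h (hiff.1 h')]) hα hβ
        (fun h hh => haff h (by rw [hLq] at hh; exact hh))
      rw [hLq] at hmain
      have hXρ : ∀ σ, ρ σ * X σ = ((9 + 4 * pc N : ℕ) : ℝ≥0∞) * ρ σ +
          ρ σ * (afterSplit S c k F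
            (edgeList ends (fun i => w (σ i)) (arrange r (l.filter fun i => i ∈ L)),
              edgeList ends (fun i => w (σ i))
                (arrange r (l.filter fun i => i ∉ L)))).expCost := by
        intro σ
        by_cases h : lightSet w t A σ = L
        · simp only [hX]
          rw [hS.partition_val, light_edgeList, heavy_edgeList, arrange_edgeList,
            arrange_edgeList, ← hA, h]
          ring
        · have : ρ σ = 0 := if_neg h
          simp [this]
      calc ∑ σ, ρ σ * X σ
          = ((9 + 4 * pc N : ℕ) : ℝ≥0∞) * ∑ σ, ρ σ + ∑ σ, ρ σ * (afterSplit S c k F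
            (edgeList ends (fun i => w (σ i)) (arrange r (l.filter fun i => i ∈ L)),
              edgeList ends (fun i => w (σ i))
                (arrange r (l.filter fun i => i ∉ L)))).expCost := by
            simp only [hXρ]
            rw [Finset.sum_add_distrib, Finset.mul_sum]
        _ ≤ _ := by
            rw [add_mul]
            exact add_le_add le_rfl hmain
    -- the expected number of edges that survive the filter
    have hcross : ∑ σ, ν σ * ((crossing ends A (lightSet w t A σ)).card : ℝ≥0∞) ≤
        ENNReal.ofReal (n * (N - q) / (q + 1)) * ∑ σ, ν σ := by
      have h := sum_card_crossing_le ends w t A ν hνx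
      have e1 : ∑ σ, ν σ * (((crossing ends A (lightSet w t A σ)).card : ℝ≥0∞) *
          ((lightSet w t A σ).card + 1)) =
          (∑ σ, ν σ * ((crossing ends A (lightSet w t A σ)).card : ℝ≥0∞)) * (q + 1) := by
        rw [Finset.sum_mul]
        refine Finset.sum_congr rfl fun σ _ => ?_
        by_cases h0 : ν σ = 0
        · simp [h0]
        · rw [hνq σ h0, mul_assoc]
      have e2 : ∑ σ, ν σ * ((n : ℝ≥0∞) * (A \ lightSet w t A σ).card) =
          (n * (N - q : ℕ)) * ∑ σ, ν σ := by
        rw [Finset.mul_sum]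
        refine Finset.sum_congr rfl fun σ _ => ?_
        by_cases h0 : ν σ = 0
        · simp [h0]
        · rw [Finset.card_sdiff_of_subset (lightSet_subset _ _ _ _), hνq σ h0, hAcard, mul_comm]
      rw [e1, e2] at h
      have hqN : q ≤ N := by omega
      have e3 : ENNReal.ofReal (n * (N - q) / (q + 1)) =
          (n * (N - q : ℕ) : ℝ≥0∞) / (q + 1) := by
        rw [ENNReal.ofReal_div_of_pos (by positivity), ← Nat.cast_sub hqN,
          ENNReal.ofReal_mul (by positivity), ENNReal.ofReal_natCast, ENNReal.ofReal_natCast,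
          ENNReal.ofReal_add (by positivity) zero_le_one, ENNReal.ofReal_natCast,
          ENNReal.ofReal_one]
      rw [e3, ENNReal.div_eq_inv_mul, mul_assoc, ← ENNReal.div_eq_inv_mul]
      rw [ENNReal.le_div_iff_mul_le (Or.inl (by simp)) (Or.inl (by simp))]
      exact h
    have hfinal : ((9 + 4 * pc N : ℕ) : ℝ≥0∞) + (ENNReal.ofReal (φ q) + fc N +
        (ENNReal.ofReal α + ENNReal.ofReal β * ENNReal.ofReal (n * (N - q) / (q + 1)))) ≤
        ENNReal.ofReal (φ N) := by
      have hqN : (q : ℝ) ≤ N := by exact_mod_cast (by omega : q ≤ N)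
      have hH : 0 ≤ (n : ℝ) * (N - q) / (q + 1) :=
        div_nonneg (mul_nonneg (by positivity) (by linarith)) (by positivity)
      have hφq := hφ0 q
      rw [← ENNReal.ofReal_mul hβ, ← ENNReal.ofReal_natCast, ← ENNReal.ofReal_natCast (fc N),
        ← ENNReal.ofReal_add hα (by positivity), ← ENNReal.ofReal_add hφq (by positivity),
        ← ENNReal.ofReal_add (by positivity) (by positivity),
        ← ENNReal.ofReal_add (by positivity) (by positivity)]
      refine ENNReal.ofReal_le_ofReal ?_
      have := hd N hNm
      push_cast at this ⊢
      linarith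
    calc ∑ σ, ν σ * X σ ≤ _ := hfib
      _ = (((9 + 4 * pc N : ℕ) : ℝ≥0∞) + (ENNReal.ofReal (φ q) + fc N + ENNReal.ofReal α)) *
          ∑ σ, ν σ + ENNReal.ofReal β *
            ∑ σ, ν σ * ((crossing ends A (lightSet w t A σ)).card : ℝ≥0∞) := by
          rw [Finset.mul_sum, Finset.mul_sum, ← Finset.sum_add_distrib]
          exact Finset.sum_congr rfl fun σ _ => by ring
      _ ≤ (((9 + 4 * pc N : ℕ) : ℝ≥0∞) + (ENNReal.ofReal (φ q) + fc N + ENNReal.ofReal α)) *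
          ∑ σ, ν σ + ENNReal.ofReal β *
            (ENNReal.ofReal (n * (N - q) / (q + 1)) * ∑ σ, ν σ) := by gcongr
      _ = (((9 + 4 * pc N : ℕ) : ℝ≥0∞) + (ENNReal.ofReal (φ q) + fc N +
        (ENNReal.ofReal α + ENNReal.ofReal β * ENNReal.ofReal (n * (N - q) / (q + 1))))) *
          ∑ σ, ν σ := by ring
      _ ≤ ENNReal.ofReal (φ N) * ∑ σ, ν σ := by gcongr
  calc _ = ∑ σ, μ σ * X σ := by
        rw [Finset.mul_sum, ← Finset.sum_add_distrib]
        exact Finset.sum_congr rfl fun σ _ => by rw [hX]; ring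
    _ ≤ ∑ σ, μ σ * ENNReal.ofReal (φ N) := hgoal
    _ = _ := by rw [← Finset.sum_mul, mul_comm]

/-- A sum over the edges is a sum over the weights that are assigned to them. -/
lemma sum_map_wt_edgeList (ends : Fin m → Fin n × Fin n) {l : List (Fin m)} (hl : l.Nodup)
    (σ : Equiv.Perm (Fin m)) (g : ℝ → ℝ≥0∞) :
    ((edgeList ends (fun i => w (σ i)) l).map fun e => g e.wt).sum =
      ∑ j, if σ.symm j ∈ l.toFinset then g (w j) else 0 := by
  have e1 : ((edgeList ends (fun i => w (σ i)) l).map fun e => g e.wt).sum =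
      ∑ i ∈ l.toFinset, g (w (σ i)) := by
    rw [List.sum_toFinset _ hl, edgeList, List.map_map]
    rfl
  rw [e1, ← Equiv.sum_comp σ]
  simp only [Equiv.symm_apply_apply]
  rw [← Finset.sum_filter, Finset.filter_univ_mem]

lemma length_filter_eq_sum {α : Type} (l : List α) (p : α → Prop) [DecidablePred p] :
    ((l.filter p).length : ℝ≥0∞) = (l.map fun a => if p a then 1 else 0).sum := by
  induction l with
  | nil => simp
  | cons a l ih =>
    simp only [List.filter_cons, List.map_cons, List.sum_cons, ← ih]
    by_cases h : p a
    · simp [h, add_comm]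
    · simp [h]

/-- The induction on the recursion depth. The pivot is chosen by its weight `w j` instead of its
position: the event that the pivot has weight `w j` and is balanced depends only on the set of
weights assigned to the edges of the call, and therefore preserves exchangeability. -/
theorem costBound_filterRec (hS : Implements S c r pc fc s) (hc : 3 < c) (hs : 0 ≤ s)
    (h₀ : 0 ≤ d₀) (h₁ : 0 ≤ d₁) (hfc : Monotone fc)
    (hd : ∀ N ≤ m, ((9 + 4 * pc N + fc N : ℕ) : ℝ) ≤ d₀ + d₁ * N)
    (hw : Function.Injective w) (k : ℕ) :
    CostBound S c w (potential c (s + 1) d₀ d₁ n) k := by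
  induction k with
  | zero =>
    intro ends l F μ _ _ _ _ _
    simp only [filterRec, Rand.expCost_interrupt, mul_zero, Finset.sum_const_zero, zero_le]
  | succ k ih =>
    intro ends l F μ hl hloop hF hFl hμ
    set es : Equiv.Perm (Fin m) → List (Edge n) := fun σ =>
      edgeList ends (fun i => w (σ i)) l with hes
    have hlen : ∀ σ, (es σ).length = l.length := fun σ => length_edgeList _ _ _
    have hvalid : ∀ σ, ValidInput (es σ) := fun σ =>
      validInput_edgeList _ _ _ hl hloop (hw.comp σ.injective)
    by_cases hN : (l.length : ℝ) ≤ c * n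
    · rw [Finset.mul_sum]
      refine Finset.sum_le_sum fun σ _ => ?_
      rw [mul_comm]
      gcongr
      rw [filterRec, Rand.expCost_lift_bind, if_pos (by rw [length_edgeList]; exact hN)]
      calc ((tick 1).cost : ℝ≥0∞) + (S.base (es σ) F).expCost
          ≤ ENNReal.ofReal 1 + ENNReal.ofReal s := by
            refine add_le_add (by simp [tick]) (hS.base_cost _ _ (hvalid σ) ?_ ?_)
            · rw [hlen]
              exact hN
            · exact (isRepMap_edgeList _ _ _).2 ⟨hF, hFl⟩
        _ = ENNReal.ofReal (s + 1) := by rw [← ENNReal.ofReal_add zero_le_one hs, add_comm]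
        _ ≤ _ := ENNReal.ofReal_le_ofReal (le_potential hc (by linarith) h₀ h₁ _ _)
    · push Not at hN
      have hlpos : 0 < l.length := by
        have : (0 : ℝ) < l.length := lt_of_le_of_lt (by positivity) hN
        exact_mod_cast this
      have hn : 0 < n := Fin.pos (ends (l.get ⟨0, hlpos⟩)).1
      have h4 : 4 ≤ l.length := by
        have h1 : (1 : ℝ) ≤ n := by exact_mod_cast hn
        have : ((3 : ℕ) : ℝ) < l.length := by
          push_cast
          nlinarith
        exact_mod_cast this
      set b : Equiv.Perm (Fin m) → ℕ := fun σ =>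
        ((es σ).filter fun e => Balanced (es σ) e.wt).length with hb
      have hb0 : ∀ σ, (b σ : ℝ≥0∞) ≠ 0 := by
        intro σ
        have := length_le_four_mul_balanced (hvalid σ).2.1 (by rw [hlen]; exact h4)
        rw [hlen] at this
        have h0 : b σ ≠ 0 := by
          change l.length ≤ 4 * b σ at this
          omega
        exact_mod_cast h0
      have hbsum : ∀ σ, (b σ : ℝ≥0∞) =
          ∑ j, if σ.symm j ∈ l.toFinset ∧ Balanced (es σ) (w j) then 1 else 0 := by
        intro σ
        simp only [hb]
        rw [length_filter_eq_sum,
          sum_map_wt_edgeList ends hl σ (fun t => if Balanced (es σ) t then 1 else 0)]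
        simp only [ite_and]
      have hinv : ∀ τ : Equiv.Perm (Fin m), (∀ i ∉ l.toFinset, τ i = i) → ∀ σ j,
          ((σ * τ).symm j ∈ l.toFinset ∧ Balanced (es (σ * τ)) (w j)) ↔
            (σ.symm j ∈ l.toFinset ∧ Balanced (es σ) (w j)) := by
        intro τ hτ σ j
        have e1 : (σ * τ).symm j ∈ l.toFinset ↔ σ.symm j ∈ l.toFinset := by
          rw [← mem_of_fixes hτ]
          have : τ ((σ * τ).symm j) = σ.symm j := by
            rw [Equiv.eq_symm_apply]
            exact (σ * τ).apply_symm_apply j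
          rw [this]
        simp only [hes]
        rw [e1, balanced_edgeList hl, balanced_edgeList hl, card_lightSet_mul hτ]
      have hbinv : ∀ τ : Equiv.Perm (Fin m), (∀ i ∉ l.toFinset, τ i = i) → ∀ σ,
          (b (σ * τ) : ℝ≥0∞) = b σ := by
        intro τ hτ σ
        rw [hbsum, hbsum]
        exact Finset.sum_congr rfl fun j _ => if_congr (hinv τ hτ σ j) rfl rfl
      -- the assignments under which the pivot has weight `w j`
      set ν : Fin m → Equiv.Perm (Fin m) → ℝ≥0∞ := fun j σ =>
        if σ.symm j ∈ l.toFinset ∧ Balanced (es σ) (w j) then μ σ / b σ else 0 with hν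
      have hνx : ∀ j, Exchangeable (ν j) l.toFinset := by
        intro j τ hτ σ
        simp only [hν]
        rw [hμ τ hτ, hbinv τ hτ]
        exact if_congr (hinv τ hτ σ j) rfl rfl
      have hνsum : ∀ σ, ∑ j, ν j σ = μ σ := by
        intro σ
        have : ∀ j, ν j σ = μ σ / b σ *
            if σ.symm j ∈ l.toFinset ∧ Balanced (es σ) (w j) then 1 else 0 := by
          intro j
          simp only [hν]
          split_ifs <;> simp
        simp only [this]
        rw [← Finset.mul_sum, ← hbsum]
        exact ENNReal.div_mul_cancel (hb0 σ) (by simp)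
      set Y : Equiv.Perm (Fin m) → ℝ → ℝ≥0∞ := fun σ t =>
        (afterSplit S c k F (S.partition t (es σ)).val).expCost with hY
      have hpoint : ∀ σ, μ σ * (filterRec S c (k + 1) (es σ) F).expCost ≤
          ((9 + 4 * pc l.length : ℕ) : ℝ≥0∞) * μ σ + ∑ j, ν j σ * Y σ (w j) := by
        intro σ
        have h1 := expCost_splitBalanced_bind_le hS (hvalid σ).2.1 (by rw [hlen]; exact h4)
          (afterSplit S c k F) k
        rw [hlen, sum_map_wt_edgeList ends hl σ
          (fun t => if Balanced (es σ) t then Y σ t else 0)] at h1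
        have h2 : (filterRec S c (k + 1) (es σ) F).expCost =
            1 + (splitBalanced S (es σ) k >>= afterSplit S c k F).expCost := by
          rw [filterRec, Rand.expCost_lift_bind, if_neg (by rw [hlen]; exact not_le.2 hN)]
          simp only [tick, Nat.cast_one]
          rfl
        rw [h2]
        calc μ σ * (1 + (splitBalanced S (es σ) k >>= afterSplit S c k F).expCost)
            ≤ μ σ * (1 + (4 * ((pc l.length + 2 : ℕ) : ℝ≥0∞) +
              (∑ j, if σ.symm j ∈ l.toFinset then
                if Balanced (es σ) (w j) then Y σ (w j) else 0 else 0) / b σ)) := by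
              gcongr
          _ = ((9 + 4 * pc l.length : ℕ) : ℝ≥0∞) * μ σ + μ σ / b σ *
              (∑ j, if σ.symm j ∈ l.toFinset then
                if Balanced (es σ) (w j) then Y σ (w j) else 0 else 0) := by
              simp only [ENNReal.div_eq_inv_mul]
              push_cast
              ring
          _ = _ := by
              rw [Finset.mul_sum]
              congr 1
              refine Finset.sum_congr rfl fun j _ => ?_
              simp only [hν, ite_and]
              split_ifs <;> simp
      calc ∑ σ, μ σ * (filterRec S c (k + 1) (es σ) F).expCost
          ≤ ∑ σ, (((9 + 4 * pc l.length : ℕ) : ℝ≥0∞) * μ σ + ∑ j, ν j σ * Y σ (w j)) :=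
            Finset.sum_le_sum fun σ _ => hpoint σ
        _ = ∑ σ, ∑ j, (((9 + 4 * pc l.length : ℕ) : ℝ≥0∞) * ν j σ + ν j σ * Y σ (w j)) := by
            refine Finset.sum_congr rfl fun σ _ => ?_
            rw [Finset.sum_add_distrib, ← Finset.mul_sum, hνsum]
        _ = ∑ j, (((9 + 4 * pc l.length : ℕ) : ℝ≥0∞) * ∑ σ, ν j σ +
              ∑ σ, ν j σ * Y σ (w j)) := by
            rw [Finset.sum_comm]
            refine Finset.sum_congr rfl fun j _ => ?_
            rw [Finset.sum_add_distrib, Finset.mul_sum]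
        _ ≤ ∑ j, ENNReal.ofReal (potential c (s + 1) d₀ d₁ n l.length) * ∑ σ, ν j σ := by
            refine Finset.sum_le_sum fun j _ => ?_
            refine sum_expCost_pivot_le hS hc hs h₀ h₁ hfc hd hw hn ih hl hloop hF hFl (hνx j) hN
              (w j) fun σ hσ => ?_
            by_contra h
            exact hσ (if_neg fun h' => h h'.2)
        _ = _ := by
            rw [← Finset.mul_sum, Finset.sum_comm]
            simp only [hνsum]

/-- The expected cost of Filter-Borůvka under uniformly random assignments of weights. -/
theorem randomWeightMean_expectedCost_le (hS : Implements S c r pc fc s) (hc : 3 < c) (hs : 0 ≤ s)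
    (h₀ : 0 ≤ d₀) (h₁ : 0 ≤ d₁) (hfc : Monotone fc)
    (hd : ∀ N ≤ m, ((9 + 4 * pc N + fc N : ℕ) : ℝ) ≤ d₀ + d₁ * N)
    (hw : Function.Injective w) (G : InputGraph n m) (init : ℕ) :
    randomWeightMean w (fun u => expectedCost S c init (G.edges u)) ≤
      init + ENNReal.ofReal (potential c (s + 1) d₀ d₁ n m) := by
  have hedges : ∀ u, G.edges u = edgeList G.ends u (List.finRange m) := by
    intro u
    simp only [InputGraph.edges, edgeList, List.ofFn_eq_map]
  have hm : (m.factorial : ℝ≥0∞) ≠ 0 := by exact_mod_cast m.factorial_ne_zero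
  unfold randomWeightMean expectedCost
  rw [ENNReal.div_le_iff hm (by simp)]
  rw [ENNReal.finsetSum_iSup_of_monotone]
  · refine iSup_le fun k => ?_
    have h := costBound_filterRec hS hc hs h₀ h₁ hfc hd hw k G.ends (List.finRange m)
      ⟨fun v => v, []⟩ (fun _ => 1) (List.nodup_finRange m) (fun i _ => G.loopless i)
      (fun _ => rfl) (fun _ _ => ⟨rfl, rfl⟩) (fun _ _ _ => rfl)
    simp only [one_mul, List.length_finRange, Finset.sum_const, Finset.card_univ,
      Fintype.card_perm, Fintype.card_fin, nsmul_eq_mul, mul_one] at h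
    simp only [Rand.expCost_lift_bind, hedges]
    rw [Finset.sum_add_distrib, add_mul]
    refine add_le_add (le_of_eq ?_) h
    simp [tick, Fintype.card_perm, mul_comm]
  · intro σ
    refine monotone_nat_of_le_succ fun k => ?_
    exact (Rand.Extends.rfl.bind fun _ => filterRec_extends S c k _ _).expCost_le

end Recursion

/-! ### Results and costs of deterministic programs -/

@[simp] lemma Timed.pure_val {α : Type} (a : α) : (pure a : Timed α).val = a := rfl
@[simp] lemma Timed.pure_cost {α : Type} (a : α) : (pure a : Timed α).cost = 0 := rfl
@[simp] lemma Timed.bind_val {α β : Type} (x : Timed α) (f : α → Timed β) :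
    (x >>= f).val = (f x.val).val := rfl
@[simp] lemma Timed.bind_cost {α β : Type} (x : Timed α) (f : α → Timed β) :
    (x >>= f).cost = x.cost + (f x.val).cost := rfl
@[simp] lemma tick_cost (k : ℕ) : (tick k).cost = k := rfl
@[simp] lemma rd_val {ι α : Type} (A : ι → α) (i : ι) : (rd A i).val = A i := rfl
@[simp] lemma rd_cost {ι α : Type} (A : ι → α) (i : ι) : (rd A i).cost = 1 := rfl
@[simp] lemma wr_val {ι α : Type} [DecidableEq ι] (A : ι → α) (i : ι) (x : α) :
    (wr A i x).val = Function.update A i x := rfl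
@[simp] lemma wr_cost {ι α : Type} [DecidableEq ι] (A : ι → α) (i : ι) (x : α) :
    (wr A i x).cost = 1 := rfl

/-! ### The parallel subroutines -/

lemma foldr_max_le (l : List ℕ) {M : ℕ} (h : ∀ a ∈ l, a ≤ M) : l.foldr max 0 ≤ M := by
  induction l with
  | nil => exact Nat.zero_le _
  | cons a l ih =>
    exact max_le (h a (by simp)) (ih fun b hb => h b (by simp [hb]))

lemma parMap_cost_le {α β : Type} (f : α → Timed β) (l : List α) {M : ℕ}
    (h : ∀ a, (f a).cost ≤ M) : (parMap f l).cost ≤ Nat.clog 2 l.length + M + 1 := by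
  unfold parMap
  have := foldr_max_le (l.map fun a => (f a).cost) (M := M) (by simp [h])
  simp only
  omega

lemma parPack_cost_le {α : Type} (p : α → Timed Bool) (l : List α)
    (h : ∀ a, (p a).cost ≤ 1) : (parPack p l).cost ≤ 4 * Nat.clog 2 l.length + 5 := by
  have := parMap_cost_le p l h
  simp only [parPack]
  omega

lemma parPartition_cost_le (t : ℝ) (es : List (Edge n)) :
    (parPartition t es).cost ≤ 8 * Nat.clog 2 es.length + 10 := by
  simp only [parPartition, Timed.bind_cost, Timed.pure_cost]
  have h1 := parPack_cost_le (fun e : Edge n => ⟨decide (e.wt ≤ t), 1⟩) es (fun _ => le_rfl)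
  have h2 := parPack_cost_le (fun e : Edge n => ⟨decide (t < e.wt), 1⟩) es (fun _ => le_rfl)
  omega

lemma parFilter_cost_le (P : Fin n → Fin n) (es : List (Edge n)) :
    (parFilter P es).cost ≤ 5 * Nat.clog 2 es.length + 8 := by
  simp only [parFilter, Timed.bind_cost]
  set f : Edge n → Timed (Edge n) := fun e => do
    let u ← rd P e.src
    let v ← rd P e.dst
    pure (⟨u, v, e.wt, e.tag⟩ : Edge n)
  have h1 := parMap_cost_le f es (M := 2) (fun _ => le_rfl)
  have h2 := parPack_cost_le (fun e : Edge n => ⟨decide (e.src ≠ e.dst), 1⟩) (parMap f es).val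
    (fun _ => le_rfl)
  have h3 : (parMap f es).val.length = es.length := List.length_map _
  rw [h3] at h2
  omega

lemma parFilter_val (P : Fin n → Fin n) (es : List (Edge n)) :
    (parFilter P es).val = contract P es := rfl

lemma Connected.eq_or_mem {es : List (Edge n)} {u v : Fin n} (h : Connected es u v) :
    v = u ∨ ∃ e ∈ es, e.src = v ∨ e.dst = v := by
  rcases Relation.ReflTransGen.cases_tail h with h | ⟨a, -, e, he, h | h⟩
  · exact Or.inl h
  · exact Or.inr ⟨e, he, Or.inr h.2⟩
  · exact Or.inr ⟨e, he, Or.inl h.1⟩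

/-- Composition with an idempotent map `L` that moves vertices only to ends of edges. -/
lemma merges_comp {P L : Fin n → Fin n} {es es' : List (Edge n)} (hP : IsRepMap P es)
    (hidem : ∀ v, L (L v) = L v) (hL : ∀ v, L v = v ∨ ∃ e ∈ es, e.src = L v ∨ e.dst = L v)
    (hes : es' ⊆ es) (he : ∀ e ∈ es', L e.src = L e.dst) : Merges P es' fun v => L (P v) := by
  refine ⟨fun v => ?_, fun v => by simp only [hP.1], fun e h => ?_⟩
  · have hfix : P (L (P v)) = L (P v) := by
      rcases hL (P v) with h | ⟨e, h, h' | h'⟩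
      · rw [h, hP.1]
      · rw [← h', (hP.2 e h).1]
      · rw [← h', (hP.2 e h).2]
    simp only [hfix, hidem]
  · simp only [(hP.2 e (hes h)).1, (hP.2 e (hes h)).2]
    exact he e h

lemma IsComponentMap.merges {P L : Fin n → Fin n} {es : List (Edge n)}
    (hL : IsComponentMap es L) (hP : IsRepMap P es) : Merges P es fun v => L (P v) :=
  merges_comp hP (fun v => ((hL.2 v (L v)).2 (hL.1 v)).symm) (fun v => (hL.1 v).eq_or_mem)
    (List.Subset.refl _)
    fun e he => (hL.2 _ _).2 (Relation.ReflTransGen.single ⟨e, he, Or.inl ⟨rfl, rfl⟩⟩)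

lemma ParallelMSF.base_possible {B : ParallelMSF n} {es : List (Edge n)} {F F' : Forest n}
    (h : (B.base es F).Possible F') :
    ∃ r ∈ (B.run es).support, F'.P = fun v => r.1.P (F.P v) := by
  unfold ParallelMSF.base at h
  obtain ⟨out, ⟨t, ht⟩, h₁⟩ := h.bind
  obtain ⟨P, hP, h₂⟩ := h₁.bind
  obtain ⟨T, -, h₃⟩ := h₂.bind
  obtain ⟨⟨F₁, t₁⟩, hr, he⟩ := (PMF.mem_support_map_iff _ _ _).1 ((PMF.mem_support_iff _ _).2 ht)
  simp only [Prod.mk.injEq, Option.some.injEq] at he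
  obtain ⟨rfl, -⟩ := he
  refine ⟨_, hr, ?_⟩
  have hF := h₃.eq_of_pure
  have hP := hP.eq_of_lift
  rw [hF, hP]
  rfl

/-- The loop that stores the representatives bounds the span of the base case from below. -/
lemma ParallelMSF.clog_lt_worstSpan (B : ParallelMSF n) {c : ℝ} (hc : 0 ≤ c) :
    ((Nat.clog 2 n + 1 : ℕ) : ℝ≥0∞) ≤ B.worstSpan c := by
  have hv : ValidInput ([] : List (Edge n)) := by simp [ValidInput]
  have hlen : ((([] : List (Edge n)).length : ℕ) : ℝ) ≤ c * n := by
    simp only [List.length_nil, Nat.cast_zero]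
    positivity
  refine le_trans ?_ (le_iSup₂_of_le [] hv (le_iSup₂_of_le hlen ⟨fun v => v, []⟩ le_rfl))
  unfold ParallelMSF.base
  rw [Rand.expCost_bind]
  refine le_trans ?_ le_add_self
  calc ((Nat.clog 2 n + 1 : ℕ) : ℝ≥0∞)
      = mean (B.run []) fun _ => ((Nat.clog 2 n + 1 : ℕ) : ℝ≥0∞) := (mean_const _ _).symm
    _ ≤ _ := by
      refine le_trans ?_ (le_of_eq (mean_map _ _ _).symm)
      refine mean_mono _ fun r _ => ?_
      simp only [onSome, Rand.expCost_lift_bind]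
      refine le_trans ?_ le_self_add
      simp only [parTabulate]
      exact_mod_cast (by omega)

lemma parSubroutines_implements (B : ParallelMSF n) {c : ℝ} (hB : B.worstSpan c ≠ ⊤) :
    Implements (parSubroutines B) c false (fun N => 8 * Nat.clog 2 N + 10)
      (fun N => 5 * Nat.clog 2 N + 8) (B.worstSpan c).toReal where
  partition_val _ _ := rfl
  partition_cost := parPartition_cost_le
  filter_val := parFilter_val
  filter_cost := parFilter_cost_le
  base_cost es F hv hlen _ := by
    rw [ENNReal.ofReal_toReal hB]
    exact le_iSup₂_of_le es hv (le_iSup₂_of_le hlen F le_rfl)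
  base_merges es F F' hv hF h := by
    obtain ⟨r, hr, he⟩ := B.base_possible h
    rw [he]
    exact (B.correct es hv r hr).1.merges hF

lemma InputGraph.le_sq (G : InputGraph n m) : m ≤ n * n := by
  have hinj : Function.Injective G.ends := fun i j h => G.simple (by simp only [h])
  simpa using Fintype.card_le_of_injective _ hinj

/-- The number of base cases is logarithmic in `m / n`. -/
lemma baseCount_le {c : ℝ} (hc : 3 < c) (n m : ℕ) :
    baseCount c n m ≤ 36 * Real.log (2 + (m : ℝ) / n) := by
  have h2 : 0.6931471803 < Real.log 2 := Real.log_two_gt_d9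
  have hx : 0 ≤ (m : ℝ) / n := by positivity
  have hl : Real.log 2 ≤ Real.log (2 + (m : ℝ) / n) :=
    Real.log_le_log (by norm_num) (by linarith)
  unfold baseCount
  split_ifs with h
  · linarith
  · have h1 : Real.log (m / (c * n)) ≤ Real.log (2 + (m : ℝ) / n) := by
      rcases n.eq_zero_or_pos with rfl | hn
      · simp only [CharP.cast_eq_zero, mul_zero, div_zero, Real.log_zero]
        exact Real.log_nonneg (by norm_num)
      have hn' : (0 : ℝ) < n := by exact_mod_cast hn
      have hm : (0 : ℝ) < m := lt_of_le_of_lt (by positivity) (not_le.1 h)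
      apply Real.log_le_log (by positivity)
      have : (m : ℝ) / (c * n) ≤ m / n := by
        apply div_le_div_of_nonneg_left hm.le hn'
        nlinarith
      linarith
    linarith

theorem parallel_span_bound (c : ℝ) (hc : 3 < c) :
    ∃ C : ℝ, ∀ (n m : ℕ) (G : InputGraph n m) (w : Fin m → ℝ) (B : ParallelMSF n),
      Function.Injective w →
        randomWeightMean w (parExpectedSpan c B G) ≤
          ENNReal.ofReal (C * Real.log (2 + (m : ℝ) / (n : ℝ))) * B.worstSpan c := by
  refine ⟨10000, fun n m G w B hw => ?_⟩
  have hx : 0 ≤ (m : ℝ) / n := by positivity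
  have h2 : 0.6931471803 < Real.log 2 := Real.log_two_gt_d9
  set ℓ := Real.log (2 + (m : ℝ) / n) with hℓ
  have hl : Real.log 2 ≤ ℓ := Real.log_le_log (by norm_num) (by linarith)
  by_cases hB : B.worstSpan c = ⊤
  · rw [hB, ENNReal.mul_top]
    · exact le_top
    · simp only [ne_eq, ENNReal.ofReal_eq_zero, not_le]
      linarith
  set s := (B.worstSpan c).toReal with hs
  have hsn : (Nat.clog 2 n : ℝ) + 1 ≤ s := by
    have h := ENNReal.toReal_mono hB (B.clog_lt_worstSpan (c := c) (by linarith))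
    rw [ENNReal.toReal_natCast] at h
    push_cast at h
    exact h
  have hcl0 : (0 : ℝ) ≤ Nat.clog 2 n := by positivity
  have hclog : ∀ N ≤ m, Nat.clog 2 N ≤ 2 * Nat.clog 2 n := by
    -- simple graphs have at most `n ^ 2` edges
    intro N hN
    apply Nat.clog_le_of_le_pow
    calc N ≤ n * n := hN.trans G.le_sq
      _ ≤ 2 ^ Nat.clog 2 n * 2 ^ Nat.clog 2 n :=
        Nat.mul_le_mul (Nat.le_pow_clog one_lt_two n) (Nat.le_pow_clog one_lt_two n)
      _ = _ := by rw [two_mul, pow_add]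
  -- the other work of a call has span at most `57 + 37 * clog N ≤ 74 * (1 + clog n) ≤ 74 * s`
  have hmain := randomWeightMean_expectedCost_le (d₀ := 74 * s) (d₁ := 0) (w := w)
    (parSubroutines_implements B hB) hc (by linarith) (by linarith) le_rfl
    (fun a b h => by
      have := Nat.clog_mono_right 2 h
      simp only
      omega)
    (fun N hN => by
      have : (Nat.clog 2 N : ℝ) ≤ 2 * Nat.clog 2 n := by exact_mod_cast hclog N hN
      push_cast
      linarith) hw G (Nat.clog 2 n + 1)
  rw [← hs] at hmain
  refine hmain.trans ?_
  have hg := baseCount_le hc n m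
  have hg1 := one_le_baseCount hc n m
  have hpot : 0 ≤ potential c (s + 1) (74 * s) 0 n m :=
    (by linarith : 0 ≤ s + 1).trans (le_potential hc (by linarith) (by linarith) le_rfl n m)
  rw [← ENNReal.ofReal_toReal hB, ← hs, ← ENNReal.ofReal_mul (by linarith),
    ← ENNReal.ofReal_natCast, ← ENNReal.ofReal_add (by positivity) hpot]
  refine ENNReal.ofReal_le_ofReal ?_
  have e1 : potential c (s + 1) (74 * s) 0 n m ≤ (76 * s) * (36 * ℓ) := by
    unfold potential
    have : (s + 1 + 74 * s) * baseCount c n m ≤ (76 * s) * (36 * ℓ) := by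
      apply mul_le_mul <;> linarith
    simp only [mul_zero, zero_div, zero_mul]
    linarith
  have e2 : s ≤ s * (2 * ℓ) := by
    apply le_mul_of_one_le_right <;> linarith
  have e3 : 0 ≤ s * ℓ := mul_nonneg (by linarith) (by linarith)
  push_cast
  linarith

/-! ### Sequential loops -/

lemma seqLoop_val {α σ : Type} (f : σ → α → Timed σ) (l : List α) (s : σ) :
    (seqLoop f l s).val = l.foldl (fun s a => (f s a).val) s := by
  induction l generalizing s with
  | nil => rfl
  | cons a l ih => exact ih _

lemma seqLoop_cost_le {α σ : Type} (f : σ → α → Timed σ) {M : ℕ} (h : ∀ s a, (f s a).cost ≤ M)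
    (l : List α) (s : σ) : (seqLoop f l s).cost ≤ (M + 1) * l.length + 1 := by
  induction l generalizing s with
  | nil => simp [seqLoop]
  | cons a l ih =>
    have h1 := ih (f s a).val
    have h2 := h s a
    simp only [seqLoop, Timed.bind_cost, tick_cost, List.length_cons]
    have h3 : (M + 1) * (l.length + 1) = (M + 1) * l.length + (M + 1) := by ring
    omega

/-- Loop invariants: `I d s` says that the loop state is `s` after the elements of `d`. -/
lemma foldl_invariant {α σ : Type} (f : σ → α → σ) (I : List α → σ → Prop) (l : List α) (s : σ)
    (h0 : I [] s) (hstep : ∀ d a r s, l = d ++ a :: r → I d s → I (d ++ [a]) (f s a)) :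
    I l (l.foldl f s) := by
  suffices h : ∀ r d s, l = d ++ r → I d s → I l (r.foldl f s) from h l [] s rfl h0
  intro r
  induction r with
  | nil =>
    intro d s hl hI
    rw [hl, List.append_nil]
    exact hI
  | cons a r ih =>
    intro d s hl hI
    exact ih (d ++ [a]) (f s a) (by simp [hl]) (hstep d a r s hl hI)

lemma seqPartition_val (t : ℝ) (es : List (Edge n)) : (seqPartition t es).val =
    (arrange true (es.filter fun e => e.wt ≤ t), arrange true (es.filter fun e => t < e.wt)) := by
  unfold seqPartition
  rw [seqLoop_val]
  refine foldl_invariant _ (fun d q => q = (arrange true (d.filter fun e => e.wt ≤ t),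
    arrange true (d.filter fun e => t < e.wt))) es _ rfl ?_
  rintro d e _ q - rfl
  simp only [Timed.bind_val, arrange, if_true]
  by_cases h : e.wt ≤ t
  · simp [h, not_lt.2 h]
  · simp [h, not_le.1 h]

lemma seqPartition_cost_le (t : ℝ) (es : List (Edge n)) :
    (seqPartition t es).cost ≤ 3 * es.length + 1 := by
  refine seqLoop_cost_le _ (M := 2) (fun s a => ?_) es _
  simp only [Timed.bind_cost, tick_cost]
  split_ifs <;> simp

lemma seqFilter_val (P : Fin n → Fin n) (es : List (Edge n)) :
    (seqFilter P es).val = arrange true (contract P es) := by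
  unfold seqFilter
  rw [seqLoop_val]
  refine foldl_invariant _ (fun d q => q = arrange true (contract P d)) es _ rfl ?_
  rintro d e _ q - rfl
  simp only [Timed.bind_val, arrange, if_true, contract, Edge.relabel, rd_val, List.map_append,
    List.filter_append, List.map_cons, List.map_nil]
  by_cases h : P e.src = P e.dst <;> simp [h]

lemma seqFilter_cost_le (P : Fin n → Fin n) (es : List (Edge n)) :
    (seqFilter P es).cost ≤ 5 * es.length + 1 := by
  refine seqLoop_cost_le _ (M := 4) (fun s a => ?_) es _
  simp only [Timed.bind_cost, tick_cost, rd_cost]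
  split_ifs <;> simp

/-! ### A Borůvka round -/

/-- `v` is an end of `e`. -/
def Edge.IsEnd (e : Edge n) (v : Fin n) : Prop := e.src = v ∨ e.dst = v

instance (e : Edge n) (v : Fin n) : Decidable (e.IsEnd v) := by
  unfold Edge.IsEnd
  infer_instance

/-- The end of `e` other than `v`. -/
def Edge.other (e : Edge n) (v : Fin n) : Fin n := if e.src = v then e.dst else e.src

lemma Edge.isEnd_other (e : Edge n) (v : Fin n) : e.IsEnd (e.other v) := by
  unfold Edge.IsEnd Edge.other
  split_ifs <;> simp

lemma Edge.other_ne {e : Edge n} (he : e.src ≠ e.dst) {v : Fin n} (hv : e.IsEnd v) :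
    e.other v ≠ v := by
  unfold Edge.other
  rcases hv with rfl | rfl
  · simpa using he.symm
  · simp [he]

lemma Edge.other_other {e : Edge n} (he : e.src ≠ e.dst) {v : Fin n} (hv : e.IsEnd v) :
    e.other (e.other v) = v := by
  unfold Edge.other
  rcases hv with rfl | rfl
  · simp [he]
  · simp [he]

/-- `best` stores a lightest incident edge of each vertex. -/
def IsLightest (es : List (Edge n)) (best : Fin n → Option (Edge n)) : Prop :=
  ∀ v, (best v = none → ∀ e ∈ es, ¬ e.IsEnd v) ∧
    ∀ e, best v = some e → e ∈ es ∧ e.IsEnd v ∧ ∀ f ∈ es, f.IsEnd v → e.wt ≤ f.wt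

/-- The lighter one of a recorded edge and `e`. -/
noncomputable def lighter (o : Option (Edge n)) (e : Edge n) : Option (Edge n) :=
  match o with
  | none => some e
  | some f => if e.wt < f.wt then some e else some f

lemma improve_val (best : Fin n → Option (Edge n)) (v : Fin n) (e : Edge n) :
    (improve best v e).val = Function.update best v (lighter (best v) e) := by
  unfold improve lighter
  simp only [Timed.bind_val, rd_val]
  cases h : best v with
  | none => rfl
  | some f =>
    simp only [Timed.bind_val]
    split_ifs
    · rfl
    · rw [← h, Function.update_eq_self]
      rfl

lemma improve_cost_le (best : Fin n → Option (Edge n)) (v : Fin n) (e : Edge n) :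
    (improve best v e).cost ≤ 3 := by
  unfold improve
  simp only [Timed.bind_cost, rd_cost, rd_val]
  cases best v with
  | none => simp
  | some f =>
    simp only [Timed.bind_cost, tick_cost]
    split_ifs <;> simp

lemma lightest_isLightest {es : List (Edge n)} (hes : ∀ e ∈ es, e.src ≠ e.dst) :
    IsLightest es (lightest es).val := by
  unfold lightest
  simp only [Timed.bind_val, seqLoop_val]
  refine foldl_invariant _ IsLightest es _ (fun v => by simp) ?_
  intro d e r best hl hI v
  have hne : e.src ≠ e.dst := hes e (by simp [hl])
  have hval : (improve (improve best e.src e).val e.dst e).val v =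
      if e.IsEnd v then lighter (best v) e else best v := by
    simp only [improve_val, Edge.IsEnd]
    by_cases h1 : e.dst = v
    · subst h1
      simp [hne.symm]
    · by_cases h2 : e.src = v
      · subst h2
        simp [Function.update_of_ne hne]
      · simp [h1, h2, Function.update_of_ne (Ne.symm h1), Function.update_of_ne (Ne.symm h2)]
  rw [hval]
  obtain ⟨h1, h2⟩ := hI v
  split_ifs with hv
  · cases hb : best v with
    | none =>
      refine ⟨by simp [lighter], fun f hf => ?_⟩
      obtain rfl : e = f := by simpa [lighter] using hf
      refine ⟨by simp, hv, fun g hg hgv => ?_⟩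
      rcases List.mem_append.1 hg with hg | hg
      · exact absurd hgv (h1 hb g hg)
      · rw [List.mem_singleton.1 hg]
    | some f₀ =>
      obtain ⟨h3, h4, h5⟩ := h2 f₀ hb
      constructor
      · unfold lighter
        simp only
        split_ifs <;> simp
      · intro f hf
        simp only [lighter] at hf
        split_ifs at hf with hlt
        · obtain rfl : e = f := by simpa using hf
          refine ⟨by simp, hv, fun g hg hgv => ?_⟩
          rcases List.mem_append.1 hg with hg | hg
          · exact hlt.le.trans (h5 g hg hgv)
          · rw [List.mem_singleton.1 hg]
        · obtain rfl : f₀ = f := by simpa using hf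
          refine ⟨by simp [h3], h4, fun g hg hgv => ?_⟩
          rcases List.mem_append.1 hg with hg | hg
          · exact h5 g hg hgv
          · rw [List.mem_singleton.1 hg]
            exact not_lt.1 hlt
  · constructor
    · intro hb f hf
      rcases List.mem_append.1 hf with hf | hf
      · exact h1 hb f hf
      · rwa [List.mem_singleton.1 hf]
    · intro f hb
      obtain ⟨h3, h4, h5⟩ := h2 f hb
      refine ⟨by simp [h3], h4, fun g hg hgv => ?_⟩
      rcases List.mem_append.1 hg with hg | hg
      · exact h5 g hg hgv
      · exact absurd (List.mem_singleton.1 hg ▸ hgv) hv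

lemma lightest_cost_le (es : List (Edge n)) : (lightest es).cost ≤ n + 7 * es.length + 1 := by
  unfold lightest
  simp only [Timed.bind_cost, tick_cost, add_assoc]
  refine Nat.add_le_add_left (seqLoop_cost_le _ (M := 6) (fun s a => ?_) es _) n
  simp only [Timed.bind_cost]
  exact Nat.add_le_add (improve_cost_le _ _ _) (improve_cost_le _ _ _)

/-- The pseudo-forest of the lightest incident edges. -/
def pseudoParent (best : Fin n → Option (Edge n)) (v : Fin n) : Fin n :=
  match best v with
  | none => v
  | some e => e.other v

/-- The rooted forest obtained by breaking the 2-cycles of a pseudo-forest. -/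
def treeParent (H : Fin n → Fin n) (v : Fin n) : Fin n :=
  if H (H v) = v ∧ v < H v then v else H v

lemma hook_val {vs : List (Fin n)} {best : Fin n → Option (Edge n)}
    (hvs : ∀ v ∉ vs, best v = none) : (hook vs best).val = pseudoParent best := by
  have h : ∀ u, (hook vs best).val u = if u ∈ vs then pseudoParent best u else u := by
    unfold hook
    simp only [Timed.bind_val, seqLoop_val]
    refine foldl_invariant _
      (fun d (par : Fin n → Fin n) => ∀ u, par u = if u ∈ d then pseudoParent best u else u) vs _ (by simp) ?_
    intro d v r par _ hI u
    simp only [rd_val]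
    cases hb : best v with
    | none =>
      simp only [Timed.pure_val, hI, List.mem_append, List.mem_singleton]
      by_cases huv : u = v
      · subst huv
        simp [pseudoParent, hb]
      · simp [huv]
    | some e =>
      simp only [Timed.bind_val, wr_val, List.mem_append, List.mem_singleton]
      by_cases huv : u = v
      · subst huv
        simp [pseudoParent, hb, Edge.other]
      · simp [huv, hI]
  funext u
  rw [h]
  split_ifs with hu
  · rfl
  · simp [pseudoParent, hvs u hu]

lemma hook_cost_le (vs : List (Fin n)) (best : Fin n → Option (Edge n)) :
    (hook vs best).cost ≤ n + 4 * vs.length + 1 := by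
  unfold hook
  simp only [Timed.bind_cost, tick_cost, add_assoc]
  refine Nat.add_le_add_left (seqLoop_cost_le _ (M := 3) (fun s a => ?_) vs _) n
  simp only [Timed.bind_cost, rd_cost, rd_val]
  cases best a <;> simp

lemma breakCycles_val {vs : List (Fin n)} (hvs : vs.Nodup) {H : Fin n → Fin n}
    (hH : ∀ v ∉ vs, H v = v) : (breakCycles vs H).val = treeParent H := by
  have h : ∀ u, (breakCycles vs H).val u = if u ∈ vs then treeParent H u else H u := by
    unfold breakCycles
    rw [seqLoop_val]
    refine foldl_invariant _
      (fun d (par : Fin n → Fin n) => ∀ u, par u = if u ∈ d then treeParent H u else H u) vs _ (by simp) ?_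
    intro d v r par hl hI u
    have hvd : v ∉ d := by
      rw [hl, List.nodup_append] at hvs
      intro hv
      exact hvs.2.2 v hv v (by simp) rfl
    have hpv : par v = H v := by rw [hI, if_neg hvd]
    -- in-place updates do not interfere: a 2-cycle is broken at its smaller vertex only
    have hcond : (par (H v) = v ∧ v < H v) ↔ (H (H v) = v ∧ v < H v) := by
      rw [hI (H v)]
      split_ifs with hd
      · unfold treeParent
        split_ifs with hb
        · constructor
          · rintro ⟨h1, h2⟩
            exact absurd (h1 ▸ h2) (lt_irrefl _)
          · rintro ⟨h1, h2⟩
            rw [h1] at hb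
            exact absurd (hb.2.trans h2) (lt_irrefl _)
        · rfl
      · rfl
    change (if par (par v) = v ∧ v < par v then wr par v v else pure par).val u = _
    rw [hpv]
    simp only [List.mem_append, List.mem_singleton]
    by_cases huv : u = v
    · subst huv
      simp only [or_true, if_true, treeParent]
      by_cases hc : H (H u) = u ∧ u < H u
      · rw [if_pos (hcond.2 hc), if_pos hc]
        simp
      · rw [if_neg fun h => hc (hcond.1 h), if_neg hc]
        exact hpv
    · simp only [huv, or_false]
      split_ifs with h1 h2 h2 <;> simp [Function.update_of_ne huv, hI, h2]
  funext u
  rw [h]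
  split_ifs with hu
  · rfl
  · simp [treeParent, hH u hu]

lemma breakCycles_cost_le (vs : List (Fin n)) (par : Fin n → Fin n) :
    (breakCycles vs par).cost ≤ 6 * vs.length + 1 := by
  refine seqLoop_cost_le _ (M := 5) (fun s a => ?_) vs _
  simp only [Timed.bind_cost, tick_cost, rd_cost]
  split_ifs <;> simp

lemma collect_cost_le (vs : List (Fin n)) (best : Fin n → Option (Edge n))
    (par : Fin n → Fin n) (T : List ℕ) : (collect vs best par T).cost ≤ 5 * vs.length + 1 := by
  refine seqLoop_cost_le _ (M := 4) (fun s a => ?_) vs _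
  simp only [Timed.bind_cost, tick_cost, rd_cost]
  by_cases h : (rd par a).val = a
  · rw [if_pos h]
    simp
  · rw [if_neg h]
    simp only [Timed.bind_cost, rd_cost, rd_val]
    cases best a <;> simp

/-- Each pass of pointer doubling at least doubles the distance to which a vertex points. -/
lemma pointerDoubling_val {vs : List (Fin n)} {K : Fin n → Fin n} (hK : ∀ v ∉ vs, K v = v) (k : ℕ)
    {N : ℕ} {par : Fin n → Fin n} (hpar : ∀ v, ∃ j, N ≤ j ∧ par v = K^[j] v) :
    ∀ v, ∃ j, N * 2 ^ k ≤ j ∧ (pointerDoubling vs k par).val v = K^[j] v := by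
  induction k generalizing N par with
  | zero => simpa [pointerDoubling] using hpar
  | succ k ih =>
    simp only [pointerDoubling, Timed.bind_val]
    rw [pow_succ', ← mul_assoc]
    refine ih ?_
    have hloop := foldl_invariant
      (fun (par : Fin n → Fin n) v => (((do
        let p ← rd par v
        let g ← rd par p
        wr par v g) : Timed _)).val)
      (fun d par => (∀ v, ∃ j, N ≤ j ∧ par v = K^[j] v) ∧
        ∀ v ∈ d, ∃ j, N * 2 ≤ j ∧ par v = K^[j] v) vs par ⟨hpar, by simp⟩ (by
      intro d v r par _ ⟨h1, h2⟩
      simp only [Timed.bind_val, rd_val, wr_val]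
      have hv : ∃ j, N * 2 ≤ j ∧ par (par v) = K^[j] v := by
        obtain ⟨j, hj, e⟩ := h1 v
        obtain ⟨j', hj', e'⟩ := h1 (par v)
        refine ⟨j' + j, by omega, ?_⟩
        rw [e', e, Function.iterate_add_apply]
      constructor
      · intro u
        by_cases huv : u = v
        · subst huv
          obtain ⟨j, hj, e⟩ := hv
          exact ⟨j, by omega, by simpa using e⟩
        · rw [Function.update_of_ne huv]
          exact h1 u
      · intro u hu
        by_cases huv : u = v
        · subst huv
          simpa using hv
        · rw [Function.update_of_ne huv]
          rcases List.mem_append.1 hu with hu | hu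
          · exact h2 u hu
          · exact absurd (List.mem_singleton.1 hu) huv)
    rw [seqLoop_val]
    intro v
    by_cases hv : v ∈ vs
    · exact hloop.2 v hv
    · obtain ⟨j, -, e⟩ := hloop.1 v
      refine ⟨N * 2, le_rfl, ?_⟩
      rw [Function.iterate_fixed (hK v hv)] at e ⊢
      exact e

lemma pointerDoubling_cost_le (vs : List (Fin n)) (k : ℕ) (par : Fin n → Fin n) :
    (pointerDoubling vs k par).cost ≤ k * (4 * vs.length + 1) := by
  induction k generalizing par with
  | zero => simp [pointerDoubling]
  | succ k ih =>
    simp only [pointerDoubling, Timed.bind_cost]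
    rw [add_mul, one_mul, add_comm]
    exact Nat.add_le_add (ih _) (seqLoop_cost_le _ (M := 3) (fun s a => by simp) vs _)

lemma activeRoots_val (vs : List (Fin n)) (best : Fin n → Option (Edge n))
    (root : Fin n → Fin n) : (activeRoots vs best root).val =
      (vs.filter fun v => root v = v ∧ (best v).isSome).reverse := by
  unfold activeRoots
  rw [seqLoop_val]
  refine foldl_invariant _
    (fun d acc => acc = (d.filter fun v => root v = v ∧ (best v).isSome).reverse) vs _ rfl ?_
  rintro d v _ acc - rfl
  change (if root v = v ∧ (best v).isSome then pure (v :: _) else pure _ : Timed _).val = _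
  by_cases h : root v = v ∧ (best v).isSome
  · rw [if_pos h]
    simp [List.filter_append, h.1, h.2]
  · rw [if_neg h]
    rw [List.filter_append, List.filter_cons_of_neg (by simpa using h)]
    simp

lemma activeRoots_cost_le (vs : List (Fin n)) (best : Fin n → Option (Edge n))
    (root : Fin n → Fin n) : (activeRoots vs best root).cost ≤ 5 * vs.length + 1 := by
  refine seqLoop_cost_le _ (M := 4) (fun s a => ?_) vs _
  simp only [Timed.bind_cost, tick_cost, rd_cost]
  split_ifs <;> simp

lemma updateReps_val (root P : Fin n → Fin n) :
    (updateReps root P).val = fun v => root (P v) := by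
  have h : ∀ u, (updateReps root P).val u =
      if u ∈ List.finRange n then root (P u) else P u := by
    unfold updateReps
    rw [seqLoop_val]
    refine foldl_invariant _
      (fun d (par : Fin n → Fin n) => ∀ u, par u = if u ∈ d then root (P u) else P u) _ _ (by simp) ?_
    intro d v r par hl hI u
    have hvd : v ∉ d := by
      have hnd := List.nodup_finRange n
      rw [hl, List.nodup_append] at hnd
      intro hv
      exact hnd.2.2 v hv v (by simp) rfl
    simp only [Timed.bind_val, rd_val, wr_val, List.mem_append, List.mem_singleton]
    by_cases huv : u = v
    · subst huv
      simp [hI, hvd]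
    · simp [huv, hI]
  funext u
  rw [h, if_pos (List.mem_finRange u)]

lemma updateReps_cost_le (root P : Fin n → Fin n) : (updateReps root P).cost ≤ 4 * n + 1 := by
  have := seqLoop_cost_le (fun (P : Fin n → Fin n) v => (do
    let p ← rd P v
    let r ← rd root p
    wr P v r : Timed _)) (M := 3) (fun s a => by simp) (List.finRange n) P
  rwa [List.length_finRange] at this

section Tree

variable {es : List (Edge n)} {best : Fin n → Option (Edge n)}

/-- `v` is an end of some edge. -/
def IsEndpoint (es : List (Edge n)) (v : Fin n) : Prop := ∃ e ∈ es, e.IsEnd v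

lemma IsLightest.isSome_iff (hb : IsLightest es best) (v : Fin n) :
    (best v).isSome ↔ IsEndpoint es v := by
  constructor
  · intro h
    obtain ⟨e, he⟩ := Option.isSome_iff_exists.1 h
    exact ⟨e, ((hb v).2 e he).1, ((hb v).2 e he).2.1⟩
  · rintro ⟨e, he, hv⟩
    by_contra h
    exact (hb v).1 (by simpa using h) e he hv

lemma treeParent_eq_self_or (H : Fin n → Fin n) (v : Fin n) :
    treeParent H v = v ∨ treeParent H v = H v := by
  unfold treeParent
  split_ifs <;> simp

lemma IsLightest.pseudoParent_eq_self_or (hb : IsLightest es best) (v : Fin n) :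
    pseudoParent best v = v ∨ IsEndpoint es (pseudoParent best v) := by
  unfold pseudoParent
  cases h : best v with
  | none => exact Or.inl rfl
  | some e => exact Or.inr ⟨e, ((hb v).2 e h).1, e.isEnd_other v⟩

lemma IsLightest.treeParent_eq_self_or_isEndpoint (hb : IsLightest es best) (v : Fin n) :
    treeParent (pseudoParent best) v = v ∨ IsEndpoint es (treeParent (pseudoParent best) v) := by
  rcases treeParent_eq_self_or (pseudoParent best) v with h | h
  · exact Or.inl h
  · rw [h]
    exact hb.pseudoParent_eq_self_or v

/-- The weight of the lightest incident edge. -/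
noncomputable def bestWt (best : Fin n → Option (Edge n)) (v : Fin n) : ℝ :=
  (best v).elim 0 Edge.wt

/-- Along the paths to the roots the weights decrease, because the weights are distinct and the
2-cycles are broken. -/
lemma IsLightest.bestWt_lt (hb : IsLightest es best) (hes : ValidInput es) {v : Fin n}
    (h1 : treeParent (pseudoParent best) v ≠ v)
    (h2 : treeParent (pseudoParent best) (treeParent (pseudoParent best) v) ≠
      treeParent (pseudoParent best) v) :
    bestWt best (treeParent (pseudoParent best) v) < bestWt best v := by
  set H := pseudoParent best with hH
  have hv : treeParent H v = H v := (treeParent_eq_self_or H v).resolve_left h1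
  rw [hv] at h2 ⊢
  cases hbv : best v with
  | none =>
    exact absurd (show H v = v by simp [hH, pseudoParent, hbv]) (hv ▸ h1)
  | some e =>
    obtain ⟨he, hev, -⟩ := (hb v).2 e hbv
    have hHv : H v = e.other v := by simp [hH, pseudoParent, hbv]
    have hend : e.IsEnd (H v) := by
      rw [hHv]
      exact e.isEnd_other v
    obtain ⟨f, hf⟩ := Option.isSome_iff_exists.1 ((hb.isSome_iff (H v)).2 ⟨e, he, hend⟩)
    obtain ⟨hfe, -, hmin⟩ := (hb (H v)).2 f hf
    have hle := hmin e he hend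
    simp only [bestWt, hbv, hf, Option.elim_some]
    refine lt_of_le_of_ne hle fun heq => ?_
    obtain rfl : f = e := List.inj_on_of_nodup_map hes.2.1 hfe he heq
    have hback : H (H v) = v := by
      have : H (H v) = f.other (H v) := by
        rw [hH] at hf ⊢
        conv_lhs => rw [pseudoParent]
        rw [hf]
      rw [this, hHv, Edge.other_other (hes.1 f he) hev]
    have c1 : ¬ v < H v := fun h => h1 (by rw [treeParent, if_pos ⟨hback, h⟩])
    have c2 : ¬ H v < v := fun h =>
      h2 (by rw [treeParent, if_pos ⟨by rw [hback], by rw [hback]; exact h⟩])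
    exact h1 (hv.trans (le_antisymm (not_lt.1 c1) (not_lt.1 c2)))

/-- The number of steps to the root is at most the number of vertices with a smaller weight,
plus one. -/
lemma IsLightest.iterate_treeParent_fixed (hb : IsLightest es best) (hes : ValidInput es)
    (A : Finset (Fin n)) (hA : ∀ v, IsEndpoint es v → v ∈ A) (N : ℕ) (v : Fin n)
    (hN : (A.filter fun u => bestWt best u < bestWt best v).card < N) :
    treeParent (pseudoParent best) ((treeParent (pseudoParent best))^[N] v) =
      (treeParent (pseudoParent best))^[N] v := by
  set K := treeParent (pseudoParent best) with hK
  induction N generalizing v with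
  | zero => exact absurd hN (Nat.not_lt_zero _)
  | succ N ih =>
    by_cases h1 : K v = v
    · rw [Function.iterate_fixed h1, h1]
    rw [Function.iterate_succ_apply]
    by_cases h2 : K (K v) = K v
    · rw [Function.iterate_fixed h2, h2]
    apply ih
    have hlt := hb.bestWt_lt hes h1 h2
    refine lt_of_lt_of_le (Finset.card_lt_card ?_) (Nat.lt_succ_iff.1 hN)
    rw [Finset.ssubset_iff_of_subset]
    · exact ⟨K v, Finset.mem_filter.2 ⟨hA _
        ((hb.treeParent_eq_self_or_isEndpoint v).resolve_left h1), hlt⟩, by simp [hK]⟩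
    · intro u hu
      obtain ⟨h3, h4⟩ := Finset.mem_filter.1 hu
      exact Finset.mem_filter.2 ⟨h3, h4.trans hlt⟩

end Tree

/-- The invariant of Borůvka's algorithm: the edges are a valid input, their ends are in the list
of active vertices, and they are representatives. -/
structure BoruvkaState.Valid (s : BoruvkaState n) : Prop where
  nodup : s.vs.Nodup
  valid : ValidInput s.es
  mem : ∀ v, IsEndpoint s.es v → v ∈ s.vs
  rep : IsRepMap s.forest.P s.es

lemma exists_root {s : BoruvkaState n} (hs : s.Valid) {best : Fin n → Option (Edge n)}
    (hb : IsLightest s.es best) (v : Fin n) :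
    ∃ j, (pointerDoubling s.vs (Nat.clog 2 s.vs.length) (treeParent (pseudoParent best))).val v =
        (treeParent (pseudoParent best))^[j + 1] v ∧
      treeParent (pseudoParent best) ((treeParent (pseudoParent best))^[j + 1] v) =
        (treeParent (pseudoParent best))^[j + 1] v := by
  set K := treeParent (pseudoParent best) with hK
  have hout : ∀ v ∉ s.vs, K v = v := by
    intro v hv
    have hnone : best v = none := by
      by_contra h
      exact hv (hs.mem v ((hb.isSome_iff v).1 (Option.isSome_iff_ne_none.2 h)))
    have : pseudoParent best v = v := by simp [pseudoParent, hnone]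
    simp [hK, treeParent, this]
  obtain ⟨j, hj, e⟩ := pointerDoubling_val hout (Nat.clog 2 s.vs.length) (N := 1) (par := K)
    (fun v => ⟨1, le_rfl, rfl⟩) v
  have hpow : s.vs.length ≤ 2 ^ Nat.clog 2 s.vs.length := Nat.le_pow_clog one_lt_two _
  have hpos : 0 < 2 ^ Nat.clog 2 s.vs.length := by positivity
  obtain ⟨j, rfl⟩ : ∃ i, j = i + 1 := ⟨j - 1, by omega⟩
  refine ⟨j, e, ?_⟩
  by_cases hv : v ∈ s.vs
  · refine hb.iterate_treeParent_fixed hs.valid s.vs.toFinset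
      (fun u hu => List.mem_toFinset.2 (hs.mem u hu)) _ v ?_
    refine lt_of_lt_of_le (Finset.card_lt_card (t := s.vs.toFinset) ?_) ?_
    · rw [Finset.ssubset_iff_of_subset (Finset.filter_subset _ _)]
      exact ⟨v, List.mem_toFinset.2 hv, by simp⟩
    · rw [List.toFinset_card_of_nodup hs.nodup]
      omega
  · rw [Function.iterate_fixed (hout v hv), hout v hv]

/-- The effect and the cost of a round. -/
lemma boruvkaRound_spec {s : BoruvkaState n} (hs : s.Valid) :
    (boruvkaRound s).val.Valid ∧ 2 * (boruvkaRound s).val.vs.length ≤ s.vs.length ∧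
      (boruvkaRound s).val.es.length ≤ s.es.length ∧
      Merges s.forest.P [] (boruvkaRound s).val.forest.P ∧
      (boruvkaRound s).val.es = arrange true (contract (boruvkaRound s).val.forest.P s.es) ∧
      (boruvkaRound s).cost ≤ 6 * n + 12 * s.es.length + 20 * s.vs.length + 8 +
        Nat.clog 2 s.vs.length * (4 * s.vs.length + 1) := by
  obtain ⟨vs, es, ⟨P, T⟩⟩ := s
  have hrep : IsRepMap P es := hs.rep
  set best := (lightest es).val with hbest
  have hb : IsLightest es best := lightest_isLightest hs.valid.1
  have hhook : (hook vs best).val = pseudoParent best := hook_val fun v hv => by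
    by_contra h
    exact hv (hs.mem v ((hb.isSome_iff v).1 (Option.isSome_iff_ne_none.2 h)))
  set H := pseudoParent best with hH
  have hbreak : (breakCycles vs H).val = treeParent H := breakCycles_val hs.nodup fun v hv =>
    (hb.pseudoParent_eq_self_or v).resolve_right fun h => by
      have : best v = none := by
        by_contra h
        exact hv (hs.mem v ((hb.isSome_iff v).1 (Option.isSome_iff_ne_none.2 h)))
      have hHv : H v = v := by simp [hH, pseudoParent, this]
      exact hv (hs.mem v (hHv ▸ h))
  set K := treeParent H with hK
  set root := (pointerDoubling vs (Nat.clog 2 vs.length) K).val with hroot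
  have hval : (boruvkaRound ⟨vs, es, ⟨P, T⟩⟩).val = ⟨(activeRoots vs best root).val,
      (seqFilter root es).val, ⟨(updateReps root P).val, (collect vs best K T).val⟩⟩ := by
    simp only [boruvkaRound, Timed.bind_val, Timed.pure_val, ← hbest, hhook, hbreak, ← hroot]
  have hcost : (boruvkaRound ⟨vs, es, ⟨P, T⟩⟩).cost = (lightest es).cost + ((hook vs best).cost +
      ((breakCycles vs H).cost + ((collect vs best K T).cost +
        ((pointerDoubling vs (Nat.clog 2 vs.length) K).cost + ((activeRoots vs best root).cost +
          ((updateReps root P).cost + ((seqFilter root es).cost + 0))))))) := by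
    simp only [boruvkaRound, Timed.bind_cost, Timed.pure_cost, ← hbest, hhook, hbreak, ← hroot]
  have hspec : ∀ v, ∃ j, root v = K^[j + 1] v ∧ K (K^[j + 1] v) = K^[j + 1] v :=
    fun v => exists_root hs hb v
  have hKroot : ∀ v, K (root v) = root v := by
    intro v
    obtain ⟨j, h1, h2⟩ := hspec v
    rw [h1, h2]
  have hroot_fix : ∀ v, K v = v → root v = v := by
    intro v hv
    obtain ⟨j, h1, -⟩ := hspec v
    rw [h1, Function.iterate_fixed hv]
  have hidem : ∀ v, root (root v) = root v := fun v => hroot_fix _ (hKroot v)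
  have hroot_end : ∀ v, root v = v ∨ IsEndpoint es (root v) := by
    intro v
    obtain ⟨j, h1, -⟩ := hspec v
    rw [h1]
    induction j + 1 with
    | zero => exact Or.inl rfl
    | succ j ih =>
      rw [Function.iterate_succ_apply']
      rcases hb.treeParent_eq_self_or_isEndpoint (K^[j] v) with h | h
      · have h' : K (K^[j] v) = K^[j] v := h
        rw [h']
        exact ih
      · exact Or.inr h
  have hmerge : Merges P [] fun v => root (P v) :=
    merges_comp hs.rep hidem hroot_end (by simp) (by simp)
  have hcontract : contract (fun v => root (P v)) es = contract root es := by
    unfold contract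
    congr 1
    refine List.map_congr_left fun e he => ?_
    simp only [Edge.relabel]
    rw [(hrep.2 e he).1, (hrep.2 e he).2]
  have hend' : ∀ v, IsEndpoint (arrange true (contract root es)) v →
      root v = v ∧ IsEndpoint es v := by
    rintro v ⟨e, he, hev⟩
    obtain ⟨e', he', rfl, -⟩ := mem_contract.1 (mem_arrange.1 he)
    have hx : ∃ x, root x = v ∧ IsEndpoint es x := by
      rcases hev with h | h
      · exact ⟨e'.src, h, e', he', Or.inl rfl⟩
      · exact ⟨e'.dst, h, e', he', Or.inr rfl⟩
    obtain ⟨x, rfl, hx⟩ := hx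
    refine ⟨hidem x, ?_⟩
    rcases hroot_end x with h | h
    · rw [h]
      exact hx
    · exact h
  rw [hcost, hval]
  simp only [activeRoots_val, seqFilter_val, updateReps_val, List.length_reverse]
  refine ⟨⟨?_, ?_, ?_, ?_⟩, ?_, ?_, hmerge, by rw [hcontract], ?_⟩
  · exact List.nodup_reverse.2 (hs.nodup.filter _)
  · exact (hs.valid.contract root).perm (arrange_perm true (contract root es))
  · intro v hv
    obtain ⟨h1, h2⟩ := hend' v hv
    have h3 := (hb.isSome_iff v).2 h2
    simp [h1, h3, hs.mem v h2]
  · rw [← hcontract]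
    exact (isRepMap_contract hmerge.1 es).subset
      (arrange_perm true (contract (fun v => root (P v)) es)).subset
  · -- a root with an edge lies on a 2-cycle, whose other vertex is not a root
    set act := vs.filter fun v => root v = v ∧ (best v).isSome with hact
    have hact_nd : act.Nodup := hs.nodup.filter _
    have hpair : ∀ v ∈ act, H (H v) = v ∧ H v ∈ vs ∧ H v ∉ act := by
      intro v hv
      obtain ⟨hvs, hv⟩ := List.mem_filter.1 hv
      simp only [decide_eq_true_eq] at hv
      obtain ⟨hrv, hsome⟩ := hv
      obtain ⟨e, he⟩ := Option.isSome_iff_exists.1 hsome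
      obtain ⟨hes, hev, -⟩ := (hb v).2 e he
      have hHv : H v = e.other v := by simp [hH, pseudoParent, he]
      have hne : H v ≠ v := by
        rw [hHv]
        exact Edge.other_ne (hs.valid.1 e hes) hev
      have hKv : K v = v := by
        rw [← hrv]
        exact hKroot v
      have hcyc : H (H v) = v ∧ v < H v := by
        by_contra h
        rw [hK, treeParent, if_neg h] at hKv
        exact hne hKv
      refine ⟨hcyc.1, hs.mem _ ⟨e, hes, hHv ▸ e.isEnd_other v⟩, fun hmem => ?_⟩
      have h1 := (List.mem_filter.1 hmem).2
      simp only [decide_eq_true_eq] at h1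
      have h2 : K (H v) = H v := by
        have := hKroot (H v)
        rwa [h1.1] at this
      have h3 : K (H v) = v := by
        rw [hK, treeParent, if_neg, hcyc.1]
        rintro ⟨-, h⟩
        rw [hcyc.1] at h
        exact absurd (h.trans hcyc.2) (lt_irrefl _)
      exact hne (h2.symm.trans h3)
    have hcard : act.toFinset.card ≤ (vs.toFinset \ act.toFinset).card := by
      refine Finset.card_le_card_of_injOn H (fun v hv => ?_) fun u hu v hv huv => ?_
      · obtain ⟨-, h1, h2⟩ := hpair v (List.mem_toFinset.1 hv)
        exact Finset.mem_coe.2 (Finset.mem_sdiff.2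
          ⟨List.mem_toFinset.2 h1, fun h => h2 (List.mem_toFinset.1 h)⟩)
      · rw [← (hpair u (List.mem_toFinset.1 hu)).1, huv, (hpair v (List.mem_toFinset.1 hv)).1]
    have hsub : act.toFinset ⊆ vs.toFinset := fun v hv =>
      List.mem_toFinset.2 (List.mem_filter.1 (List.mem_toFinset.1 hv)).1
    have hle := Finset.card_le_card hsub
    rw [Finset.card_sdiff_of_subset hsub, List.toFinset_card_of_nodup hact_nd,
      List.toFinset_card_of_nodup hs.nodup] at hcard
    rw [List.toFinset_card_of_nodup hact_nd, List.toFinset_card_of_nodup hs.nodup] at hle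
    change 2 * act.length ≤ vs.length
    change act.length ≤ vs.length - act.length at hcard
    change act.length ≤ vs.length at hle
    omega
  · rw [length_arrange]
    exact (List.length_filter_le _ _).trans (List.length_map _).le
  · have c1 := lightest_cost_le es
    have c2 := hook_cost_le vs best
    have c3 := breakCycles_cost_le vs H
    have c4 := collect_cost_le vs best K T
    have c5 := pointerDoubling_cost_le vs (Nat.clog 2 vs.length) K
    have c6 := activeRoots_cost_le vs best root
    have c7 := updateReps_cost_le root P
    have c8 := seqFilter_cost_le root es
    omega

/-! ### The cost of Borůvka's algorithm -/

lemma BoruvkaState.Valid.es_eq_nil {s : BoruvkaState n} (hs : s.Valid) (h : s.vs.length ≤ 1) :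
    s.es = [] := by
  rw [List.eq_nil_iff_forall_not_mem]
  intro e he
  have h1 := hs.mem e.src ⟨e, he, Or.inl rfl⟩
  have h2 := hs.mem e.dst ⟨e, he, Or.inr rfl⟩
  have hne := hs.valid.1 e he
  have := List.toFinset_card_of_nodup hs.nodup
  have hle : s.vs.toFinset.card ≤ 1 := this.trans_le h
  exact hne (Finset.card_le_one.1 hle _ (List.mem_toFinset.2 h1) _ (List.mem_toFinset.2 h2))

lemma boruvkaRounds_merges (k : ℕ) {s : BoruvkaState n} (hs : s.Valid) (hk : s.vs.length < 2 ^ k) :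
    Merges s.forest.P s.es (boruvkaRounds k s).val.forest.P := by
  induction k generalizing s with
  | zero =>
    rw [hs.es_eq_nil (by omega)]
    exact ⟨hs.rep.1, hs.rep.1, by simp⟩
  | succ k ih =>
    simp only [boruvkaRounds, Timed.bind_val]
    by_cases he : s.es = []
    · rw [if_pos (by simp [he]), he]
      exact ⟨hs.rep.1, hs.rep.1, by simp⟩
    · rw [if_neg (by simp [he])]
      simp only [Timed.bind_val]
      obtain ⟨hv, hhalf, -, hm, hes, -⟩ := boruvkaRound_spec hs
      have h := ih hv (by rw [pow_succ] at hk; omega)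
      have h' := hm.trans (es' := s.es)
        (h.subset (by rw [hes]; exact (arrange_perm _ _).symm.subset))
      simpa using h'

/-- As the number of active vertices is halved in each round, the cost of pointer doubling is
dominated by the first round. -/
lemma boruvkaRounds_cost_le (k j M : ℕ) {s : BoruvkaState n} (hs : s.Valid)
    (hj : s.vs.length < 2 ^ j) (hM : s.es.length ≤ M) (hn : s.vs.length ≤ n) :
    (boruvkaRounds k s).cost ≤
      1 + j * (26 * n + 12 * M + 9) + 10 * Nat.clog 2 n * s.vs.length := by
  induction k generalizing s j with
  | zero => simp [boruvkaRounds]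
  | succ k ih =>
    simp only [boruvkaRounds, Timed.bind_cost, tick_cost]
    by_cases he : s.es = []
    · rw [if_pos (by simp [he])]
      simp only [Timed.pure_cost]
      omega
    · rw [if_neg (by simp [he])]
      simp only [Timed.bind_cost]
      obtain ⟨hv, hhalf, hlen, -, -, hcost⟩ := boruvkaRound_spec hs
      set s' := (boruvkaRound s).val with hs'
      have hq : 1 ≤ s.vs.length := by
        by_contra h
        exact he (hs.es_eq_nil (by omega))
      obtain ⟨j, rfl⟩ : ∃ i, j = i + 1 := by
        refine ⟨j - 1, ?_⟩
        rcases j with _ | j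
        · rw [pow_zero] at hj
          omega
        · rfl
      have h := ih j hv (by rw [pow_succ] at hj; omega) (hlen.trans hM) (by omega)
      have hclog : Nat.clog 2 s.vs.length ≤ Nat.clog 2 n := Nat.clog_mono_right 2 hn
      have h1 : Nat.clog 2 s.vs.length * (4 * s.vs.length + 1) ≤
          Nat.clog 2 n * (5 * s.vs.length) := Nat.mul_le_mul hclog (by omega)
      have h2 : 10 * Nat.clog 2 n * s'.vs.length ≤ Nat.clog 2 n * (5 * s.vs.length) := by
        calc 10 * Nat.clog 2 n * s'.vs.length = Nat.clog 2 n * (5 * (2 * s'.vs.length)) := by ring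
          _ ≤ _ := by gcongr
      have h3 : (j + 1) * (26 * n + 12 * M + 9) =
        j * (26 * n + 12 * M + 9) + (26 * n + 12 * M + 9) := by ring
      have h4 : 10 * Nat.clog 2 n * s.vs.length =
        Nat.clog 2 n * (5 * s.vs.length) + Nat.clog 2 n * (5 * s.vs.length) := by ring
      linarith

lemma initial_valid {es : List (Edge n)} {F : Forest n} (hv : ValidInput es)
    (hF : IsRepMap F.P es) : BoruvkaState.Valid ⟨List.finRange n, es, F⟩ :=
  ⟨List.nodup_finRange n, hv, fun v _ => List.mem_finRange v, hF⟩

lemma seqBoruvka_merges {es : List (Edge n)} {F : Forest n} (hv : ValidInput es)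
    (hF : IsRepMap F.P es) : Merges F.P es (seqBoruvka es F).val.P :=
  boruvkaRounds_merges n (initial_valid hv hF) (by simpa using Nat.lt_two_pow_self)

lemma seqBoruvka_cost_le {es : List (Edge n)} {F : Forest n} (hv : ValidInput es)
    (hF : IsRepMap F.P es) : (seqBoruvka es F).cost ≤
      n + (1 + (Nat.clog 2 n + 1) * (26 * n + 12 * es.length + 9) + 10 * Nat.clog 2 n * n) := by
  have h := boruvkaRounds_cost_le n (Nat.clog 2 n + 1) es.length (initial_valid hv hF)
    (by
      have h := Nat.le_pow_clog one_lt_two n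
      have h' : 0 < 2 ^ Nat.clog 2 n := by positivity
      simp only [List.length_finRange, pow_succ]
      omega) le_rfl (by simp)
  simp only [List.length_finRange] at h
  simp only [seqBoruvka, Timed.bind_cost, tick_cost, Timed.pure_cost]
  omega

lemma clog_add_one_le {n : ℕ} (hn : 2 ≤ n) : (Nat.clog 2 n : ℝ) + 1 ≤ 5 * Real.log n := by
  have h2 : 0.6931471803 < Real.log 2 := Real.log_two_gt_d9
  have hlog : Real.log 2 ≤ Real.log n := Real.log_le_log (by norm_num) (by exact_mod_cast hn)
  have hpow : 2 ^ (Nat.clog 2 n - 1) < n := by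
    simpa using Nat.pow_pred_clog_lt_self one_lt_two (show 1 < n by omega)
  have h1 : ((Nat.clog 2 n - 1 : ℕ) : ℝ) * Real.log 2 ≤ Real.log n := by
    rw [← Real.log_pow]
    exact Real.log_le_log (by positivity) (by exact_mod_cast hpow.le)
  have hpos : 1 ≤ Nat.clog 2 n := Nat.clog_pos one_lt_two hn
  rw [Nat.cast_sub hpos] at h1
  push_cast at h1
  have h3 : (0 : ℝ) ≤ (Nat.clog 2 n : ℝ) - 1 := by
    have : (1 : ℝ) ≤ Nat.clog 2 n := by exact_mod_cast hpos
    linarith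
  nlinarith

lemma seqSubroutines_implements {n : ℕ} (hn : 2 ≤ n) {c : ℝ} (hc : 3 < c) :
    Implements (seqSubroutines n) c true (fun N => 3 * N + 1) (fun N => 5 * N + 1)
      ((48 + 12 * c) * (5 * (n * Real.log n))) where
  partition_val := seqPartition_val
  partition_cost := seqPartition_cost_le
  filter_val := seqFilter_val
  filter_cost := seqFilter_cost_le
  base_cost es F hv hlen hF := by
    change (Rand.lift (seqBoruvka es F)).expCost ≤ _
    rw [Rand.expCost_lift, ← ENNReal.ofReal_natCast]
    refine ENNReal.ofReal_le_ofReal ?_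
    have h : ((seqBoruvka es F).cost : ℝ) ≤ n + (1 + ((Nat.clog 2 n : ℝ) + 1) *
        (26 * n + 12 * es.length + 9) + 10 * Nat.clog 2 n * n) := by
      exact_mod_cast seqBoruvka_cost_le hv hF
    have hn' : (2 : ℝ) ≤ n := by exact_mod_cast hn
    have hl := clog_add_one_le hn
    have hl0 : (0 : ℝ) ≤ Nat.clog 2 n := by positivity
    have h1 : (26 * (n : ℝ) + 12 * es.length + 9) ≤ (35 + 12 * c) * n := by
      nlinarith
    have h2 : ((Nat.clog 2 n : ℝ) + 1) * (26 * n + 12 * es.length + 9) ≤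
        ((Nat.clog 2 n : ℝ) + 1) * ((35 + 12 * c) * n) := by gcongr
    have h3 : (1 : ℝ) + n ≤ 2 * n * (Nat.clog 2 n + 1) := by nlinarith
    calc ((seqBoruvka es F).cost : ℝ) ≤ (48 + 12 * c) * n * (Nat.clog 2 n + 1) := by
          nlinarith
      _ ≤ (48 + 12 * c) * n * (5 * Real.log n) := by
          have : 0 ≤ (48 + 12 * c) * n := mul_nonneg (by linarith) (by linarith)
          gcongr
      _ = _ := by ring
  base_merges es F F' hv hF h := by
    rw [Rand.Possible.eq_of_lift h]
    exact seqBoruvka_merges hv hF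

theorem sequential_time_bound (c : ℝ) (hc : 3 < c) :
    ∃ C : ℝ, ∀ (n m : ℕ) (G : InputGraph n m) (w : Fin m → ℝ),
      2 ≤ n → Function.Injective w →
        randomWeightMean w (seqExpectedTime c G) ≤
          ENNReal.ofReal
            (C * (m + n * Real.log n * Real.log (2 + (m : ℝ) / (n : ℝ)))) := by
  set a := 3 * c * 17 / (c - 3) with ha
  have hc3 : 0 < c - 3 := by linarith
  have ha0 : 0 ≤ a := by
    have : 0 < c := by linarith
    positivity
  refine ⟨a + ((48 + 12 * c) * 5 + 12) * 36 + 3, fun n m G w hn hw => ?_⟩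
  have hx : 0 ≤ (m : ℝ) / n := by positivity
  have h2 : 0.6931471803 < Real.log 2 := Real.log_two_gt_d9
  have hn' : (2 : ℝ) ≤ n := by exact_mod_cast hn
  set ℓ := Real.log (2 + (m : ℝ) / n) with hℓ
  have hl : Real.log 2 ≤ ℓ := Real.log_le_log (by norm_num) (by linarith)
  have hlog : Real.log 2 ≤ Real.log n := Real.log_le_log (by norm_num) hn'
  set x := (n : ℝ) * Real.log n with hx'
  have hxn : 0.69 * (n : ℝ) ≤ x := by nlinarith
  have hs0 : 0 ≤ (48 + 12 * c) * (5 * x) := by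
    have : 0 ≤ x := by linarith
    have : 0 ≤ 48 + 12 * c := by linarith
    positivity
  -- the other work of a call costs at most `9 + 4 * (3 * N + 1) + (5 * N + 1) = 14 + 17 * N`
  have hmain := randomWeightMean_expectedCost_le (d₀ := 14) (d₁ := 17) (w := w)
    (seqSubroutines_implements hn hc) hc hs0 (by norm_num) (by norm_num)
    (fun a b h => by
      simp only
      omega)
    (fun N _ => by
      push_cast
      linarith) hw G n
  refine hmain.trans ?_
  have hpot : 0 ≤ potential c ((48 + 12 * c) * (5 * x) + 1) 14 17 n m :=
    (by linarith : 0 ≤ (48 + 12 * c) * (5 * x) + 1).trans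
      (le_potential hc (by linarith) (by norm_num) (by norm_num) n m)
  rw [← ENNReal.ofReal_natCast, ← ENNReal.ofReal_add (by positivity) hpot]
  refine ENNReal.ofReal_le_ofReal ?_
  have hg := baseCount_le hc n m
  have hg1 := one_le_baseCount hc n m
  have e1 : ((48 + 12 * c) * (5 * x) + 1 + 14) * baseCount c n m ≤
      (((48 + 12 * c) * 5 + 12) * x) * (36 * ℓ) := by
    apply mul_le_mul <;> nlinarith
  have hm : (0 : ℝ) ≤ m := by positivity
  have e2 : (n : ℝ) ≤ 3 * (x * ℓ) := by
    have h1 : 0.69 * x ≤ x * ℓ := by nlinarith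
    nlinarith
  have e3 : 0 ≤ x * ℓ := mul_nonneg (by linarith) (by linarith)
  have e4 : 0 ≤ (((48 + 12 * c) * 5 + 12) * 36 + 3) * (m : ℝ) := mul_nonneg (by linarith) hm
  have e5 : 0 ≤ a * (x * ℓ) := mul_nonneg ha0 e3
  unfold potential
  rw [← ha]
  nlinarith

end FilterBoruvka

theorem mainTheorem1 (c : ℝ) (hc : 3 < c) :
    (∃ C : ℝ, ∀ (n m : ℕ) (G : FilterBoruvka.InputGraph n m) (w : Fin m → ℝ),
      2 ≤ n → Function.Injective w →
        FilterBoruvka.randomWeightMean w (FilterBoruvka.seqExpectedTime c G) ≤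
          ENNReal.ofReal
            (C * (m + n * Real.log n * Real.log (2 + (m : ℝ) / (n : ℝ))))) ∧
    (∃ C : ℝ, ∀ (n m : ℕ) (G : FilterBoruvka.InputGraph n m) (w : Fin m → ℝ)
        (B : FilterBoruvka.ParallelMSF n),
      Function.Injective w →
        FilterBoruvka.randomWeightMean w (FilterBoruvka.parExpectedSpan c B G) ≤
          ENNReal.ofReal (C * Real.log (2 + (m : ℝ) / (n : ℝ))) * B.worstSpan c) :=
  ⟨FilterBoruvka.sequential_time_bound c hc, FilterBoruvka.parallel_span_bound c hc⟩
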